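/- **Sixth-order class-a schemes.** For non-commuting $L_1,L_2$ put $C=[L_1,[L_1,L_2]]$ and $D=[L_2,[L_1,L_2]]$, where $[X,Y]=XY-YX$. Let $a=(a_1,\dots,a_5)$, $b=(b_1,\dots,b_5)$ be non-negative real step sizes obeying the class-a symmetry $a_i=a_{6-i}$ $(1\le i\le 5)$, $b_5=0$, $b_i=b_{5-i}$ $(1\le i\le 4)$. The real coefficients $e_{k_\ell}=e_{k_\ell}(a,b)$ are defined by the formal expansion, as power series in $h$ with coefficients in the free associative real algebra on $L_1,L_2$, $$\prod_{j=1}^{5}e^{a_jhL_1}e^{b_jhL_2}=\exp\Big(h(e_{1_1}L_1+e_{1_2}L_2)+h^3(e_{3_1}C+e_{3_2}D)+h^5\big(e_{5_1}[L_1,[L_1,C]]+e_{5_2}[L_1,[L_1,D]]+e_{5_3}[L_1,[L_2,D]]+e_{5_4}[L_2,[L_1,C]]+e_{5_5}[L_2,[L_2,C]]+e_{5_6}[L_2,[L_2,D]]\big)+\mathcal O(h^7)\Big)$$ (factors ordered from left to right). Consider the system $$e_{1_1}=e_{1_2}=1,\qquad e_{3_2}=0,\qquad e_{5_4}=e_{5_6}=0.\tag{1}$$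 Put $c=e_{3_1}$, $\tilde e_{5_1}=e_{5_1}-c^2$, $e=e_{5_2}$. 1. System (1) has a solution $(a,b)$ of this kind for which the following hold up to errors of at most $10^{-15}$: $a_1=0.0741652386084523$, $a_2=0.3312015955219320$, $a_3=0.1892663317392310$, $b_1=0.2357603332527950$, $b_2=0.2642396667472050$, $e_{3_1}=3.4513723374828328\cdot10^{-3}$, $\tilde e_{5_1}=-2.8754632332335723\cdot10^{-5}$, $e_{5_3}=-7.1694217000153600\cdot10^{-6}$, $e_{5_2}=-4.2236874448321610\cdot10^{-5}$, $e_{5_5}=-1.3885239090889685\cdot10^{-5}$. 2. Let $(a,b)$ be any solution of (1) of this kind with $a_3>0$. Let $\dot x=(J-R)x$ be a linear autonomous port-Hamiltonian system on $\mathbb R^n$, i.e. $J,R\in\mathbb R^{n\times n}$, $J^T=-J$, $R=R^T\ge 0$, with Hamiltonian $H(x)=\tfrac12x^Tx$. Set $L_1=\bar R=-R$, $L_2=J$, let $C,D$ be the corresponding matrix commutators, and for $h\in\mathbb R$ let $$Z=\tilde e_{5_1}[L_1,[L_1,C]]+e_{5_3}[L_1,[L_2,D]]+e_{5_5}[L_2,[L_2,C]],\qquad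 L_{cz}=J-ch^2C-h^4Z,$$ $$\Phi_h=e^{a_1hL_1}e^{b_1hL_{cz}}e^{a_2hL_1}e^{b_2hL_{cz}}\;S\;e^{b_2hL_{cz}}e^{a_2hL_1}e^{b_1hL_{cz}}e^{a_1hL_1},$$ where $S$ is either one of $$\text{(i)}\quad S=\exp\!\Big(\tfrac{a_3h}{2}L_1+\tfrac{2eh^4}{a_3}[L_1,D]\Big)\exp\!\Big(\tfrac{a_3h}{2}L_1-\tfrac{2eh^4}{a_3}[L_1,D]\Big),$$ $$\text{(ii)}\quad S=\exp\!\Big(\tfrac{eh^4}{a_3}[L_1,D]\Big)\exp(a_3hL_1)\exp\!\Big(-\tfrac{eh^4}{a_3}[L_1,D]\Big).$$ Then, in both cases, the method is of sixth order, $\Phi_h=\exp\big(h(J-R)+\mathcal O(h^7)\big)$ as $h\to0$; it preserves dissipation, $H(\Phi_hx)\le H(x)$ for all $h\ge0$ and $x\in\mathbb R^n$; and it is symmetric, $\Phi_h\Phi_{-h}=I$ for all $h\in\mathbb R$. -/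

import Mathlib

namespace PHSplitting

open Matrix

noncomputable section

/-! ### Commutators -/

/-- The commutator `C = [L₁, [L₁, L₂]]`. -/
def commC {A : Type*} [Ring A] (L₁ L₂ : A) : A := ⁅L₁, ⁅L₁, L₂⁆⁆

/-- The commutator `D = [L₂, [L₁, L₂]]`. -/
def commD {A : Type*} [Ring A] (L₁ L₂ : A) : A := ⁅L₂, ⁅L₁, L₂⁆⁆

/-! ### Formal expansion of a splitting scheme

The step `h` is the (central) variable of the power series ring over the free associative
algebra on two letters `L₁`, `L₂`. -/

/-- The free associative real algebra on two generators. -/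
abbrev Free2 : Type := FreeAlgebra ℝ (Fin 2)

/-- The first generator, standing for the operator of the first subproblem. -/
def gen₁ : Free2 := FreeAlgebra.ι ℝ 0

/-- The second generator, standing for the operator of the second subproblem. -/
def gen₂ : Free2 := FreeAlgebra.ι ℝ 1

/-- The exponential `∑ fᵏ / k!` of a formal power series `f` without constant term (only such
`f` are used); the powers `fᵏ` with `k > n` do not contribute to the coefficient of `hⁿ`. -/
def formalExp (f : PowerSeries Free2) : PowerSeries Free2 :=
  PowerSeries.mk fun n =>
    ∑ k ∈ Finset.range (n + 1), ((k.factorial : ℝ)⁻¹) • PowerSeries.coeff n (f ^ k)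

/-- The monomial `hᵏ x`. -/
def hpow (k : ℕ) (x : Free2) : PowerSeries Free2 := PowerSeries.monomial k x

/-- The formal splitting scheme `∏_{j=1}^m exp(a_j h L₁) exp(b_j h L₂)`, factors ordered from
left to right. -/
def formalScheme {m : ℕ} (a b : Fin m → ℝ) : PowerSeries Free2 :=
  (List.ofFn fun j : Fin m =>
    formalExp (hpow 1 (a j • gen₁)) * formalExp (hpow 1 (b j • gen₂))).prod

/-- The ten coefficients `e_{k_ℓ}` of the expansion of a symmetric splitting scheme up to fifth
order in the exponent. -/
structure Coeffs where
  e11 : ℝ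
  e12 : ℝ
  e31 : ℝ
  e32 : ℝ
  e51 : ℝ
  e52 : ℝ
  e53 : ℝ
  e54 : ℝ
  e55 : ℝ
  e56 : ℝ

/-- The coefficient of `h` in the exponent. -/
def Coeffs.term1 (e : Coeffs) : Free2 := e.e11 • gen₁ + e.e12 • gen₂

/-- The coefficient of `h³` in the exponent. -/
def Coeffs.term3 (e : Coeffs) : Free2 := e.e31 • commC gen₁ gen₂ + e.e32 • commD gen₁ gen₂

/-- The coefficient of `h⁵` in the exponent. -/
def Coeffs.term5 (e : Coeffs) : Free2 :=
  e.e51 • ⁅gen₁, ⁅gen₁, commC gen₁ gen₂⁆⁆ + e.e52 • ⁅gen₁, ⁅gen₁, commD gen₁ gen₂⁆⁆ +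
  e.e53 • ⁅gen₁, ⁅gen₂, commD gen₁ gen₂⁆⁆ + e.e54 • ⁅gen₂, ⁅gen₁, commC gen₁ gen₂⁆⁆ +
  e.e55 • ⁅gen₂, ⁅gen₂, commC gen₁ gen₂⁆⁆ + e.e56 • ⁅gen₂, ⁅gen₂, commD gen₁ gen₂⁆⁆

/-- `e` is the tuple of coefficients of the scheme with step sizes `a`, `b`: formally,
`∏_j exp(a_j h L₁) exp(b_j h L₂) = exp(h (…) + h³ (…) + h⁵ (…) + O(h⁷))`. -/
def IsExpansion {m : ℕ} (a b : Fin m → ℝ) (e : Coeffs) : Prop :=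
  ∃ r : PowerSeries Free2, (∀ n < 7, PowerSeries.coeff n r = 0) ∧
    formalScheme a b =
      formalExp (hpow 1 e.term1 + hpow 3 e.term3 + hpow 5 e.term5 + r)

/-- Class-a symmetry (indices from `0`): `a_i = a_{m+1-i}`, `b_m = 0`, `b_i = b_{m-i}`. -/
def ClassA {m : ℕ} (a b : Fin m → ℝ) : Prop :=
  (∀ i : Fin m, a i = a i.rev) ∧
  (∀ i : Fin m, i.val + 1 = m → b i = 0) ∧
  (∀ i j : Fin m, i.val + j.val + 2 = m → b i = b j)

/-- Non-negative class-a step sizes `a`, `b` with coefficients `e` that solve the system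
`e₁₁ = e₁₂ = 1`, `e₃₂ = 0`, `e₅₄ = e₅₆ = 0`. -/
structure IsClassASolution {m : ℕ} (a b : Fin m → ℝ) (e : Coeffs) : Prop where
  classA : ClassA a b
  a_nonneg : ∀ j, 0 ≤ a j
  b_nonneg : ∀ j, 0 ≤ b j
  expansion : IsExpansion a b e
  e11_eq : e.e11 = 1
  e12_eq : e.e12 = 1
  e32_eq : e.e32 = 0
  e54_eq : e.e54 = 0
  e56_eq : e.e56 = 0

/-- The modified coefficient `ẽ₅₁ = e₅₁ - c²`, where `c = e₃₁`. -/
def Coeffs.e51t (e : Coeffs) : ℝ := e.e51 - e.e31 ^ 2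

/-- `x` agrees with the decimal value `t` up to an error of `10⁻¹⁵`. -/
def Near (x t : ℝ) : Prop := |x - t| ≤ 1e-15

/-- The step sizes and coefficients agree with the tabulated decimal values. -/
structure IsTabulated (a b : Fin 5 → ℝ) (e : Coeffs) : Prop where
  a1 : Near (a 0) 0.0741652386084523
  a2 : Near (a 1) 0.3312015955219320
  a3 : Near (a 2) 0.1892663317392310
  b1 : Near (b 0) 0.2357603332527950
  b2 : Near (b 1) 0.2642396667472050
  e31 : Near e.e31 3.4513723374828328e-3
  e51t : Near e.e51t (-2.8754632332335723e-5)
  e53 : Near e.e53 (-7.1694217000153600e-6)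
  e52 : Near e.e52 (-4.2236874448321610e-5)
  e55 : Near e.e55 (-1.3885239090889685e-5)

/-! ### The schemes, as matrix-valued functions of the step `h` -/

/-- `Z = ẽ₅₁ [L₁,[L₁,C]] + e₅₃ [L₁,[L₂,D]] + e₅₅ [L₂,[L₂,C]]`. -/
def matZ {n : ℕ} (e : Coeffs) (L₁ L₂ : Matrix (Fin n) (Fin n) ℝ) : Matrix (Fin n) (Fin n) ℝ :=
  e.e51t • ⁅L₁, ⁅L₁, commC L₁ L₂⁆⁆ + e.e53 • ⁅L₁, ⁅L₂, commD L₁ L₂⁆⁆ +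
    e.e55 • ⁅L₂, ⁅L₂, commC L₁ L₂⁆⁆

/-- `L₂ - c h² C - h⁴ Z` with `c = e₃₁`. -/
def matLcz {n : ℕ} (e : Coeffs) (L₁ L₂ : Matrix (Fin n) (Fin n) ℝ) (h : ℝ) :
    Matrix (Fin n) (Fin n) ℝ :=
  L₂ - (e.e31 * h ^ 2) • commC L₁ L₂ - h ^ 4 • matZ e L₁ L₂

/-- The first variant of the central factor:
`exp((a₃h/2) L₁ + (2eh⁴/a₃) [L₁,D]) exp((a₃h/2) L₁ - (2eh⁴/a₃) [L₁,D])`, `e = e₅₂`. -/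
def middleI {n : ℕ} (a₃ : ℝ) (e : Coeffs) (L₁ L₂ : Matrix (Fin n) (Fin n) ℝ) (h : ℝ) :
    Matrix (Fin n) (Fin n) ℝ :=
  NormedSpace.exp ((a₃ * h / 2) • L₁ + (2 * e.e52 * h ^ 4 / a₃) • ⁅L₁, commD L₁ L₂⁆) *
  NormedSpace.exp ((a₃ * h / 2) • L₁ - (2 * e.e52 * h ^ 4 / a₃) • ⁅L₁, commD L₁ L₂⁆)

/-- The second variant of the central factor:
`exp((eh⁴/a₃) [L₁,D]) exp(a₃h L₁) exp(-(eh⁴/a₃) [L₁,D])`, `e = e₅₂`. -/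
def middleII {n : ℕ} (a₃ : ℝ) (e : Coeffs) (L₁ L₂ : Matrix (Fin n) (Fin n) ℝ) (h : ℝ) :
    Matrix (Fin n) (Fin n) ℝ :=
  NormedSpace.exp ((e.e52 * h ^ 4 / a₃) • ⁅L₁, commD L₁ L₂⁆) *
  NormedSpace.exp ((a₃ * h) • L₁) *
  NormedSpace.exp (-((e.e52 * h ^ 4 / a₃) • ⁅L₁, commD L₁ L₂⁆))

/-- The full step with central factor `S`. -/
def step {n : ℕ} (a b : Fin 5 → ℝ) (e : Coeffs) (L₁ L₂ : Matrix (Fin n) (Fin n) ℝ)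
    (S : ℝ → Matrix (Fin n) (Fin n) ℝ) (h : ℝ) : Matrix (Fin n) (Fin n) ℝ :=
  NormedSpace.exp ((a 0 * h) • L₁) * NormedSpace.exp ((b 0 * h) • matLcz e L₁ L₂ h) *
  NormedSpace.exp ((a 1 * h) • L₁) * NormedSpace.exp ((b 1 * h) • matLcz e L₁ L₂ h) *
  S h *
  NormedSpace.exp ((b 1 * h) • matLcz e L₁ L₂ h) * NormedSpace.exp ((a 1 * h) • L₁) *
  NormedSpace.exp ((b 0 * h) • matLcz e L₁ L₂ h) * NormedSpace.exp ((a 0 * h) • L₁)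

/-- The one-step method with the first variant of the central factor. -/
def methodI {n : ℕ} (a b : Fin 5 → ℝ) (e : Coeffs) (L₁ L₂ : Matrix (Fin n) (Fin n) ℝ) :
    ℝ → Matrix (Fin n) (Fin n) ℝ :=
  step a b e L₁ L₂ (middleI (a 2) e L₁ L₂)

/-- The one-step method with the second variant of the central factor. -/
def methodII {n : ℕ} (a b : Fin 5 → ℝ) (e : Coeffs) (L₁ L₂ : Matrix (Fin n) (Fin n) ℝ) :
    ℝ → Matrix (Fin n) (Fin n) ℝ :=
  step a b e L₁ L₂ (middleII (a 2) e L₁ L₂)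

/-! ### Properties of one-step methods for `ẋ = A x` -/

/-- Order `p`: `Φ_h = exp(h A + O(h^{p+1}))` as `h → 0`. -/
def HasOrder {n : ℕ} (p : ℕ) (Φ : ℝ → Matrix (Fin n) (Fin n) ℝ)
    (A : Matrix (Fin n) (Fin n) ℝ) : Prop :=
  ∃ E : ℝ → Matrix (Fin n) (Fin n) ℝ,
    (∀ i j, (fun h => E h i j) =O[nhds 0] fun h : ℝ => h ^ (p + 1)) ∧
    ∀ᶠ h in nhds (0 : ℝ), Φ h = NormedSpace.exp (h • A + E h)

/-- The Hamiltonian `H(x) = ½ xᵀx`. -/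
def hamiltonian {n : ℕ} (x : Fin n → ℝ) : ℝ := 1 / 2 * (x ⬝ᵥ x)

/-- The discrete dissipation inequality: for every step `h ≥ 0` the Hamiltonian does not
increase. -/
def DissipationPreserving {n : ℕ} (Φ : ℝ → Matrix (Fin n) (Fin n) ℝ) : Prop :=
  ∀ h : ℝ, 0 ≤ h → ∀ x : Fin n → ℝ, hamiltonian (Φ h *ᵥ x) ≤ hamiltonian x

/-- Symmetry (self-adjointness) of a one-step method: `Φ_h Φ_{-h} = 1`. -/
def IsSymmetricMethod {n : ℕ} (Φ : ℝ → Matrix (Fin n) (Fin n) ℝ) : Prop :=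
  ∀ h : ℝ, Φ h * Φ (-h) = 1

end

end PHSplitting

/-! For `L₁` symmetric and `L₂` skew, a bracket of odd length is skew exactly when it contains `L₂`
an odd number of times. Hence `C`, `[L₁,[L₁,C]]`, `[L₁,[L₂,D]]` and `[L₂,[L₂,C]]` are skew and may
be subtracted from `J` without spoiling dissipation, whereas `D` and the brackets belonging to
`e₅₂`, `e₅₄`, `e₅₆` are symmetric. System (1) removes all of these but `[L₁,[L₁,D]]`, and that one
is absorbed by the central factor through the skew matrix `[L₁,D]`.

Order. Inserting `L₂ - c h² C - h⁴ Z` for `L₂` in the formal expansion cancels the cubic term. At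
order five it also produces `-c² [L₁,[L₁,C]]`, which accounts for `ẽ₅₁ = e₅₁ - c²`. What is left is
`exp (h (L₁ + L₂)) + h⁵ e [L₁,[L₁,D]] + O(h⁶)` (`evalTrunc_series_eqO`, `nineProd_exp_eqO`). Either
central factor equals `exp (a₃ h L₁) - h⁵ e [L₁,[L₁,D]] + O(h⁶)`, and the other factors are `1 +
O(h)`, so the defect vanishes (`nineProd_middle_eqO`). The method and the exact flow are analytic
and symmetric, so their difference has odd leading order and `O(h⁶)` improves to `O(h⁷)`
(`EqO.succ_of_symmetric`). A local inverse of `exp` moves the error into the exponent.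

Symmetry comes from the palindromic product and the evenness of the modified operator in `h`.
Dissipation holds because each factor, or each of its exponentials, has an exponent with negative
semidefinite symmetric part, so it is a contraction (`Dissipative.contractive_exp`).

Existence. The coefficients are computed exactly by building the palindrome from the centre
outwards, with a symmetric Baker-Campbell-Hausdorff formula to fifth order (`eqTrunc_sandwich`). For
fixed `b₁`, the equations for `e₁₁`, `e₃₂`, `e₅₆` are linear in `a`. Their solution leaves the
single equation `e₅₄ = 0` in `b₁`, settled by the intermediate value theorem on an interval of
length `10⁻³⁰`. Crude error propagation then confirms the tabulated decimals. -/

namespace PHSplitting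

/-! ### Formal power series modulo a power of `h`, and the formal logarithm. -/

/-- The coefficients of `1, h, …, h⁶` in `F` are `c₀, …, c₆`. -/
structure HasCoeffs (F : PowerSeries Free2) (c₀ c₁ c₂ c₃ c₄ c₅ c₆ : Free2) : Prop where
  h0 : PowerSeries.coeff 0 F = c₀
  h1 : PowerSeries.coeff 1 F = c₁
  h2 : PowerSeries.coeff 2 F = c₂
  h3 : PowerSeries.coeff 3 F = c₃
  h4 : PowerSeries.coeff 4 F = c₄
  h5 : PowerSeries.coeff 5 F = c₅
  h6 : PowerSeries.coeff 6 F = c₆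

theorem HasCoeffs.mul {F G : PowerSeries Free2} {f₀ f₁ f₂ f₃ f₄ f₅ f₆ g₀ g₁ g₂ g₃ g₄ g₅ g₆ : Free2}
    (hF : HasCoeffs F f₀ f₁ f₂ f₃ f₄ f₅ f₆) (hG : HasCoeffs G g₀ g₁ g₂ g₃ g₄ g₅ g₆) :
    HasCoeffs (F * G) (f₀ * g₀) (f₀ * g₁ + f₁ * g₀) (f₀ * g₂ + f₁ * g₁ + f₂ * g₀)
      (f₀ * g₃ + f₁ * g₂ + f₂ * g₁ + f₃ * g₀)
      (f₀ * g₄ + f₁ * g₃ + f₂ * g₂ + f₃ * g₁ + f₄ * g₀)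
      (f₀ * g₅ + f₁ * g₄ + f₂ * g₃ + f₃ * g₂ + f₄ * g₁ + f₅ * g₀)
      (f₀ * g₆ + f₁ * g₅ + f₂ * g₄ + f₃ * g₃ + f₄ * g₂ + f₅ * g₁ + f₆ * g₀) := by
  have key : ∀ n, PowerSeries.coeff n (F * G) =
      ∑ i ∈ Finset.range (n + 1), PowerSeries.coeff i F * PowerSeries.coeff (n - i) G := by
    intro n
    rw [PowerSeries.coeff_mul, Finset.Nat.sum_antidiagonal_eq_sum_range_succ_mk]
  constructor <;>
    simp [key, Finset.sum_range_succ, hF.h0, hF.h1, hF.h2, hF.h3, hF.h4, hF.h5, hF.h6,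
      hG.h0, hG.h1, hG.h2, hG.h3, hG.h4, hG.h5, hG.h6]

/-- Only odd powers of `h` are allowed in the exponent: palindromic compositions produce no others.
Up to `h⁶` the powers of `f` beyond the sixth do not contribute. -/
theorem HasCoeffs.formalExp {f : PowerSeries Free2} {x y z : Free2}
    (h : HasCoeffs f 0 x 0 y 0 z 0) :
    HasCoeffs (formalExp f) 1 x ((1/2 : ℝ) • (x * x)) (y + (1/6 : ℝ) • (x * x * x))
      ((1/2 : ℝ) • (x * y + y * x) + (1/24 : ℝ) • (x * x * x * x))
      (z + (1/6 : ℝ) • (x * x * y + x * y * x + y * x * x) + (1/120 : ℝ) • (x * x * x * x * x))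
      ((1/2 : ℝ) • (x * z + z * x + y * y)
        + (1/24 : ℝ) • (x * x * x * y + x * x * y * x + x * y * x * x + y * x * x * x)
        + (1/720 : ℝ) • (x * x * x * x * x * x)) := by
  have h2 : HasCoeffs (f ^ 2) 0 0 (x * x) 0 (x * y + y * x) 0 (x * z + y * y + z * x) := by
    simpa [← pow_two f] using h.mul h
  have h3 : HasCoeffs (f ^ 3) 0 0 0 (x * x * x) 0 (x * x * y + (x * y + y * x) * x) 0 := by
    simpa [← pow_succ f] using h2.mul h
  have h4 : HasCoeffs (f ^ 4) 0 0 0 0 (x * x * x * x) 0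
      (x * x * x * y + (x * x * y + (x * y + y * x) * x) * x) := by
    simpa [← pow_succ f] using h3.mul h
  have h5 : HasCoeffs (f ^ 5) 0 0 0 0 0 (x * x * x * x * x) 0 := by
    simpa [← pow_succ f] using h4.mul h
  have h6 : HasCoeffs (f ^ 6) 0 0 0 0 0 0 (x * x * x * x * x * x) := by
    simpa [← pow_succ f] using h5.mul h
  constructor
  all_goals
    simp only [PHSplitting.formalExp, PowerSeries.coeff_mk, Finset.sum_range_succ,
      Finset.sum_range_zero, pow_one, pow_zero, PowerSeries.coeff_one, Nat.factorial,
      h.h1, h.h2, h.h3, h.h4, h.h5, h.h6, h2.h2, h2.h3, h2.h4, h2.h5, h2.h6,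
      h3.h3, h3.h4, h3.h5, h3.h6, h4.h4, h4.h5, h4.h6, h5.h5, h5.h6, h6.h6]
    simp
    try (simp only [add_mul, mul_assoc]; module)

theorem hasCoeffs_hpow (x y z : Free2) :
    HasCoeffs (hpow 1 x + hpow 3 y + hpow 5 z) 0 x 0 y 0 z 0 := by
  constructor <;>
    simp [hpow, PowerSeries.coeff_monomial, -PowerSeries.coeff_zero_eq_constantCoeff]

/-- Coefficientwise agreement up to `O(hᴺ)`. -/
def EqTrunc (N : ℕ) (F G : PowerSeries Free2) : Prop :=
  ∀ n < N, PowerSeries.coeff n F = PowerSeries.coeff n G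

namespace EqTrunc
variable {N : ℕ} {F G H K : PowerSeries Free2}

theorem refl (F : PowerSeries Free2) : EqTrunc N F F := fun _ _ => rfl
theorem trans (h : EqTrunc N F G) (h' : EqTrunc N G H) : EqTrunc N F H :=
  fun n hn => (h n hn).trans (h' n hn)

theorem mul (h : EqTrunc N F G) (h' : EqTrunc N H K) : EqTrunc N (F * H) (G * K) := by
  intro n hn
  rw [PowerSeries.coeff_mul, PowerSeries.coeff_mul]
  refine Finset.sum_congr rfl fun p hp => ?_
  have := Finset.HasAntidiagonal.mem_antidiagonal.1 hp
  rw [h _ (by omega), h' _ (by omega)]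

theorem pow (h : EqTrunc N F G) (k : ℕ) : EqTrunc N (F ^ k) (G ^ k) := by
  induction k with
  | zero => simpa using refl 1
  | succ k ih => simpa [pow_succ] using ih.mul h

theorem formalExp (h : EqTrunc N F G) : EqTrunc N (formalExp F) (formalExp G) := by
  intro n hn
  simp only [PHSplitting.formalExp, PowerSeries.coeff_mk]
  exact Finset.sum_congr rfl fun k _ => by rw [h.pow k n hn]
end EqTrunc

theorem HasCoeffs.eqTrunc {F G : PowerSeries Free2} {c₀ c₁ c₂ c₃ c₄ c₅ c₆ : Free2}
    (hF : HasCoeffs F c₀ c₁ c₂ c₃ c₄ c₅ c₆) (hG : HasCoeffs G c₀ c₁ c₂ c₃ c₄ c₅ c₆) :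
    EqTrunc 7 F G := by
  intro n hn
  interval_cases n
  · rw [hF.h0, hG.h0]
  · rw [hF.h1, hG.h1]
  · rw [hF.h2, hG.h2]
  · rw [hF.h3, hG.h3]
  · rw [hF.h4, hG.h4]
  · rw [hF.h5, hG.h5]
  · rw [hF.h6, hG.h6]

/-- Without constant term, the `n`-th coefficient of a power with exponent at least two involves
only coefficients of index below `n`. The first power is the sole exception, and this makes `exp`
triangular in the coefficients. -/
theorem coeff_pow_eq_of_eqTrunc {f g : PowerSeries Free2} {n : ℕ} (h : EqTrunc n f g)
    (hf : PowerSeries.coeff 0 f = 0) (hg : PowerSeries.coeff 0 g = 0) {k : ℕ} (hk : k ≠ 1) :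
    PowerSeries.coeff n (f ^ k) = PowerSeries.coeff n (g ^ k) := by
  obtain _ | _ | k := k
  · simp
  · exact absurd rfl hk
  rw [pow_succ f, pow_succ g, PowerSeries.coeff_mul, PowerSeries.coeff_mul]
  refine Finset.sum_congr rfl fun p hp => ?_
  have hpn := Finset.HasAntidiagonal.mem_antidiagonal.1 hp
  by_cases h0 : p.1 = 0
  · rw [PowerSeries.coeff_zero_eq_constantCoeff_apply] at hf hg
    simp [h0, hf, hg]
  by_cases h1 : p.2 = 0
  · rw [h1, hf, hg, mul_zero, mul_zero]
  · rw [h _ (by omega), h.pow (k + 1) _ (by omega)]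

/-- The coefficient of `hⁿ` in `exp f` is that of `f` plus a function of the lower ones. -/
theorem coeff_formalExp_sub {f g : PowerSeries Free2} {n : ℕ} (hn : n ≠ 0) (h : EqTrunc n f g)
    (hf : PowerSeries.coeff 0 f = 0) (hg : PowerSeries.coeff 0 g = 0) :
    PowerSeries.coeff n (formalExp f) - PowerSeries.coeff n (formalExp g) =
      PowerSeries.coeff n f - PowerSeries.coeff n g := by
  simp only [formalExp, PowerSeries.coeff_mk]
  rw [← Finset.sum_sub_distrib, Finset.sum_eq_single 1]
  · simp
  · intro k _ hk
    rw [coeff_pow_eq_of_eqTrunc h hf hg hk, sub_self]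
  · intro h1
    simp at h1
    omega

/-- Successive corrections of `g`, the `k`-th of which matches the coefficient of `h^(N + k)`
of the exponential to that of `F`. -/
noncomputable def logApprox (F g : PowerSeries Free2) (N : ℕ) : ℕ → PowerSeries Free2
  | 0 => g
  | k + 1 => logApprox F g N k + hpow (N + k)
      (PowerSeries.coeff (N + k) F - PowerSeries.coeff (N + k) (formalExp (logApprox F g N k)))

theorem eqTrunc_add_hpow (f : PowerSeries Free2) (N : ℕ) (x : Free2) :
    EqTrunc N (f + hpow N x) f := by
  intro n hn
  simp [hpow, PowerSeries.coeff_monomial, hn.ne]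

theorem eqTrunc_logApprox (F g : PowerSeries Free2) (N k j : ℕ) :
    EqTrunc (N + k) (logApprox F g N (k + j)) (logApprox F g N k) := by
  induction j with
  | zero => exact EqTrunc.refl _
  | succ j ih =>
    refine EqTrunc.trans (fun n hn => ?_) ih
    exact eqTrunc_add_hpow _ (N + (k + j)) _ n (by omega)

theorem eqTrunc_formalExp_logApprox {F g : PowerSeries Free2} {N : ℕ} (hN : 0 < N)
    (hg : PowerSeries.coeff 0 g = 0) (h : EqTrunc N F (formalExp g)) (k : ℕ) :
    EqTrunc (N + k) F (formalExp (logApprox F g N k)) := by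
  induction k with
  | zero => exact h
  | succ k ih =>
    have h0 : PowerSeries.coeff 0 (logApprox F g N k) = 0 :=
      (zero_add k ▸ eqTrunc_logApprox F g N 0 k 0 hN).trans hg
    have h1 : PowerSeries.coeff 0 (logApprox F g N (k + 1)) = 0 :=
      (zero_add (k + 1) ▸ eqTrunc_logApprox F g N 0 (k + 1) 0 hN).trans hg
    have hs := eqTrunc_logApprox F g N k 1
    intro n hn
    rcases (show n < N + k ∨ n = N + k by omega) with hn | rfl
    · rw [ih n hn, hs.formalExp n hn]
    · have := coeff_formalExp_sub (by omega) hs h1 h0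
      rw [sub_eq_iff_eq_add] at this
      rw [this]
      simp [logApprox, hpow]

/-- Any series that agrees with `exp g` up to `O(hᴺ)` equals `exp (g + r)` with `r = O(hᴺ)`. -/
theorem exists_formalExp_eq {F g : PowerSeries Free2} {N : ℕ} (hN : 0 < N)
    (hg : PowerSeries.coeff 0 g = 0) (h : EqTrunc N F (formalExp g)) :
    ∃ r : PowerSeries Free2, (∀ n < N, PowerSeries.coeff n r = 0) ∧ F = formalExp (g + r) := by
  -- The corrections stabilise: the coefficient of `hⁿ` no longer changes from stage `n + 1` on. The
  -- diagonal series is therefore their limit.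
  have hlim : ∀ k, EqTrunc (N + k)
      (PowerSeries.mk fun n => PowerSeries.coeff n (logApprox F g N (n + 1)))
      (logApprox F g N k) := by
    intro k n hn
    rw [PowerSeries.coeff_mk]
    rcases le_total (n + 1) k with hk | hk
    · obtain ⟨j, rfl⟩ := Nat.exists_eq_add_of_le hk
      exact (eqTrunc_logApprox F g N (n + 1) j n (by omega)).symm
    · obtain ⟨j, hj⟩ := Nat.exists_eq_add_of_le hk
      rw [hj]
      exact eqTrunc_logApprox F g N k j n hn
  refine ⟨PowerSeries.mk (fun n => PowerSeries.coeff n (logApprox F g N (n + 1))) - g,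
    fun n hn => ?_, ?_⟩
  · rw [map_sub, hlim 0 n hn, logApprox, sub_self]
  · rw [add_sub_cancel]
    ext1 n
    rw [eqTrunc_formalExp_logApprox hN hg h (n + 1) n (by omega),
      (hlim (n + 1)).formalExp n (by omega)]

end PHSplitting

/-! ### Symmetric Baker-Campbell-Hausdorff formula to fifth order. -/

namespace PHSplitting

noncomputable section

/-- The cubic term of `log (exp X * exp (Y + Y₃ + …) * exp X)`. -/
def sandwich₃ {A : Type*} [Ring A] [Algebra ℝ A] (X Y Y₃ : A) : A :=
  Y₃ - (1/6 : ℝ) • commC X Y - (1/6 : ℝ) • commD X Y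

/-- The quintic term of `log (exp X * exp (Y + Y₃ + Y₅ + …) * exp X)`. -/
def sandwich₅ {A : Type*} [Ring A] [Algebra ℝ A] (X Y Y₃ Y₅ : A) : A :=
  Y₅ - (1/6 : ℝ) • ⁅X, ⁅X, Y₃⁆⁆ - (1/6 : ℝ) • ⁅Y₃, ⁅X, Y⁆⁆ - (1/6 : ℝ) • ⁅Y, ⁅X, Y₃⁆⁆
    + (7/360 : ℝ) • ⁅X, ⁅X, commC X Y⁆⁆ + (1/60 : ℝ) • ⁅X, ⁅X, commD X Y⁆⁆
    - (1/90 : ℝ) • ⁅X, ⁅Y, commD X Y⁆⁆ + (1/45 : ℝ) • ⁅Y, ⁅X, commC X Y⁆⁆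
    + (1/30 : ℝ) • ⁅Y, ⁅Y, commC X Y⁆⁆ + (1/360 : ℝ) • ⁅Y, ⁅Y, commD X Y⁆⁆

theorem HasCoeffs.congr {F : PowerSeries Free2} {c₀ c₁ c₂ c₃ c₄ c₅ c₆ d₀ d₁ d₂ d₃ d₄ d₅ d₆ : Free2}
    (h : HasCoeffs F c₀ c₁ c₂ c₃ c₄ c₅ c₆) (h0 : c₀ = d₀) (h1 : c₁ = d₁) (h2 : c₂ = d₂)
    (h3 : c₃ = d₃) (h4 : c₄ = d₄) (h5 : c₅ = d₅) (h6 : c₆ = d₆) :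
    HasCoeffs F d₀ d₁ d₂ d₃ d₄ d₅ d₆ := by
  subst h0 h1 h2 h3 h4 h5 h6
  exact h

theorem hasCoeffs_formalExp_hpow_one (X : Free2) :
    HasCoeffs (formalExp (hpow 1 X)) 1 X ((1/2 : ℝ) • (X * X)) ((1/6 : ℝ) • (X * X * X))
      ((1/24 : ℝ) • (X * X * X * X)) ((1/120 : ℝ) • (X * X * X * X * X))
      ((1/720 : ℝ) • (X * X * X * X * X * X)) := by
  simpa [hpow] using (hasCoeffs_hpow X 0 0).formalExp

-- The even terms of the logarithm vanish because the product is a palindrome. The odd ones are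
-- verified by expanding all brackets into words and comparing coefficients up to `h⁶`.
set_option maxHeartbeats 1600000 in
theorem eqTrunc_sandwich (X Y Y₃ Y₅ : Free2) :
    EqTrunc 7 (formalExp (hpow 1 X) * formalExp (hpow 1 Y + hpow 3 Y₃ + hpow 5 Y₅) *
        formalExp (hpow 1 X))
      (formalExp (hpow 1 ((2 : ℝ) • X + Y) + hpow 3 (sandwich₃ X Y Y₃)
        + hpow 5 (sandwich₅ X Y Y₃ Y₅))) := by
  have hX := hasCoeffs_formalExp_hpow_one X
  refine HasCoeffs.eqTrunc (((hX.mul (hasCoeffs_hpow Y Y₃ Y₅).formalExp).mul hX).congr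
    ?_ ?_ ?_ ?_ ?_ ?_ ?_) (hasCoeffs_hpow _ _ _).formalExp
  · simp
  all_goals
    simp only [sandwich₃, sandwich₅, commC, commD, Ring.lie_def, mul_add, add_mul, mul_sub, sub_mul,
      smul_mul_assoc, mul_smul_comm, mul_assoc, mul_one, one_mul]
    module

/-- The exponent up to `O(h⁷)`. -/
def Coeffs.series (e : Coeffs) : PowerSeries Free2 :=
  hpow 1 e.term1 + hpow 3 e.term3 + hpow 5 e.term5

/-- The coefficients after multiplication by `exp (x h L₁)` from both sides. -/
def Coeffs.sandwich₁ (x : ℝ) (e : Coeffs) : Coeffs where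
  e11 := e.e11 + 2 * x
  e12 := e.e12
  e31 := e.e31 - e.e11 * e.e12 * x / 6 - e.e12 * x ^ 2 / 6
  e32 := e.e32 - e.e12 ^ 2 * x / 6
  e51 := e.e51 + e.e11 ^ 3 * e.e12 * x / 360 + e.e11 ^ 2 * e.e12 * x ^ 2 / 45
    + 7 / 180 * e.e11 * e.e12 * x ^ 3 + 7 / 360 * e.e12 * x ^ 4
    - e.e11 * e.e31 * x / 6 - e.e31 * x ^ 2 / 6
  e52 := e.e52 + e.e11 ^ 2 * e.e12 ^ 2 * x / 180 + e.e11 * e.e12 ^ 2 * x ^ 2 / 90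
    + e.e12 ^ 2 * x ^ 3 / 60 - e.e11 * e.e32 * x / 6 + e.e12 * e.e31 * x / 6 - e.e32 * x ^ 2 / 6
  e53 := e.e53 + e.e11 * e.e12 ^ 3 * x / 360 - e.e12 ^ 3 * x ^ 2 / 90 + e.e12 * e.e32 * x / 6
  e54 := e.e54 + e.e11 ^ 2 * e.e12 ^ 2 * x / 360 + e.e11 * e.e12 ^ 2 * x ^ 2 / 30
    + e.e12 ^ 2 * x ^ 3 / 45 - e.e12 * e.e31 * x / 3
  e55 := e.e55 + e.e11 * e.e12 ^ 3 * x / 180 + e.e12 ^ 3 * x ^ 2 / 30 - e.e12 * e.e32 * x / 3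
  e56 := e.e56 + e.e12 ^ 4 * x / 360

/-- The coefficients after multiplication by `exp (x h L₂)` from both sides. -/
def Coeffs.sandwich₂ (x : ℝ) (e : Coeffs) : Coeffs where
  e11 := e.e11
  e12 := e.e12 + 2 * x
  e31 := e.e31 + e.e11 ^ 2 * x / 6
  e32 := e.e32 + e.e11 * e.e12 * x / 6 + e.e11 * x ^ 2 / 6
  e51 := e.e51 - e.e11 ^ 4 * x / 360
  e52 := e.e52 - e.e11 ^ 3 * e.e12 * x / 180 - e.e11 ^ 3 * x ^ 2 / 30 - e.e11 * e.e31 * x / 3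
  e53 := e.e53 - e.e11 ^ 2 * e.e12 ^ 2 * x / 360 - e.e11 ^ 2 * e.e12 * x ^ 2 / 30
    - e.e11 ^ 2 * x ^ 3 / 45 - e.e11 * e.e32 * x / 3
  e54 := e.e54 - e.e11 ^ 3 * e.e12 * x / 360 + e.e11 ^ 3 * x ^ 2 / 90 + e.e11 * e.e31 * x / 6
  e55 := e.e55 - e.e11 ^ 2 * e.e12 ^ 2 * x / 180 - e.e11 ^ 2 * e.e12 * x ^ 2 / 90
    - e.e11 ^ 2 * x ^ 3 / 60 + e.e11 * e.e32 * x / 6 - e.e12 * e.e31 * x / 6 - e.e31 * x ^ 2 / 6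
  e56 := e.e56 - e.e11 * e.e12 ^ 3 * x / 360 - e.e11 * e.e12 ^ 2 * x ^ 2 / 45
    - 7 / 180 * e.e11 * e.e12 * x ^ 3 - 7 / 360 * e.e11 * x ^ 4
    - e.e12 * e.e32 * x / 6 - e.e32 * x ^ 2 / 6

-- The brackets arising from `sandwich₅` are rewritten in the six chosen quintic ones. Expansion
-- into words makes the Jacobi identities involved automatic.
set_option maxHeartbeats 1600000 in
theorem eqTrunc_sandwich₁ (x : ℝ) (e : Coeffs) :
    EqTrunc 7 (formalExp (hpow 1 (x • gen₁)) * formalExp e.series * formalExp (hpow 1 (x • gen₁)))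
      (formalExp (e.sandwich₁ x).series) := by
  have h1 : (2 : ℝ) • x • gen₁ + e.term1 = (e.sandwich₁ x).term1 := by
    simp only [Coeffs.term1, Coeffs.sandwich₁]
    module
  have h3 : sandwich₃ (x • gen₁) e.term1 e.term3 = (e.sandwich₁ x).term3 := by
    simp only [sandwich₃, Coeffs.term1, Coeffs.term3, Coeffs.sandwich₁, commC, commD, Ring.lie_def,
      mul_add, add_mul, mul_sub, sub_mul, smul_mul_assoc, mul_smul_comm, mul_assoc]
    module
  have h5 : sandwich₅ (x • gen₁) e.term1 e.term3 e.term5 = (e.sandwich₁ x).term5 := by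
    simp only [sandwich₅, Coeffs.term1, Coeffs.term3, Coeffs.term5, Coeffs.sandwich₁, commC, commD,
      Ring.lie_def, mul_add, add_mul, mul_sub, sub_mul, smul_mul_assoc, mul_smul_comm, mul_assoc]
    module
  rw [Coeffs.series, Coeffs.series, ← h1, ← h3, ← h5]
  exact eqTrunc_sandwich _ _ _ _

set_option maxHeartbeats 1600000 in
theorem eqTrunc_sandwich₂ (x : ℝ) (e : Coeffs) :
    EqTrunc 7 (formalExp (hpow 1 (x • gen₂)) * formalExp e.series * formalExp (hpow 1 (x • gen₂)))
      (formalExp (e.sandwich₂ x).series) := by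
  have h1 : (2 : ℝ) • x • gen₂ + e.term1 = (e.sandwich₂ x).term1 := by
    simp only [Coeffs.term1, Coeffs.sandwich₂]
    module
  have h3 : sandwich₃ (x • gen₂) e.term1 e.term3 = (e.sandwich₂ x).term3 := by
    simp only [sandwich₃, Coeffs.term1, Coeffs.term3, Coeffs.sandwich₂, commC, commD, Ring.lie_def,
      mul_add, add_mul, mul_sub, sub_mul, smul_mul_assoc, mul_smul_comm, mul_assoc]
    module
  have h5 : sandwich₅ (x • gen₂) e.term1 e.term3 e.term5 = (e.sandwich₂ x).term5 := by
    simp only [sandwich₅, Coeffs.term1, Coeffs.term3, Coeffs.term5, Coeffs.sandwich₂, commC, commD,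
      Ring.lie_def, mul_add, add_mul, mul_sub, sub_mul, smul_mul_assoc, mul_smul_comm, mul_assoc]
    module
  rw [Coeffs.series, Coeffs.series, ← h1, ← h3, ← h5]
  exact eqTrunc_sandwich _ _ _ _

end

end PHSplitting

/-! ### From formal series to functions of the step in a Banach algebra. -/

namespace PHSplitting
open Asymptotics Topology Filter
noncomputable section
variable {A : Type*} [NormedRing A]

/-- Functions of the step that agree up to `O(hᴺ)`. -/
def EqO (N : ℕ) (f g : ℝ → A) : Prop := (fun h => f h - g h) =O[𝓝 0] fun h : ℝ => h ^ N

namespace EqO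
variable {N : ℕ} {f g k l : ℝ → A}

theorem refl (f : ℝ → A) : EqO N f f := by
  simpa [EqO] using isBigO_zero _ _

theorem of_eq (h : ∀ t, f t = g t) : EqO N f g := by
  simpa [EqO, h] using isBigO_zero _ _

theorem symm (h : EqO N f g) : EqO N g f := by
  simpa [EqO] using h.neg_left

theorem trans (h : EqO N f g) (h' : EqO N g k) : EqO N f k := by
  simpa [EqO] using IsBigO.add h h'

theorem add (h : EqO N f g) (h' : EqO N k l) :
    EqO N (fun t => f t + k t) (fun t => g t + l t) := by
  simpa [EqO, add_sub_add_comm] using IsBigO.add h h'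

theorem sum {ι : Type*} {s : Finset ι} {f g : ι → ℝ → A} (h : ∀ i ∈ s, EqO N (f i) (g i)) :
    EqO N (fun t => ∑ i ∈ s, f i t) (fun t => ∑ i ∈ s, g i t) :=
  (IsBigO.sum h).congr_left fun t => by simp

theorem const_smul [NormedAlgebra ℝ A] (h : EqO N f g) (c : ℝ) : EqO N (fun t => c • f t) (fun t => c • g t) :=
  (IsBigO.const_smul_left h c).congr_left fun t => by simp [smul_sub]

theorem mul (h : EqO N f g) (h' : EqO N k l) (hf : f =O[𝓝 0] fun _ => (1 : ℝ))
    (hl : l =O[𝓝 0] fun _ => (1 : ℝ)) : EqO N (fun t => f t * k t) (fun t => g t * l t) := by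
  have h1 : (fun t => f t * (k t - l t)) =O[𝓝 0] fun t : ℝ => t ^ N := by
    simpa using hf.mul h'
  have h2 : (fun t => (f t - g t) * l t) =O[𝓝 0] fun t : ℝ => t ^ N := by
    simpa using IsBigO.mul h hl
  refine (h1.add h2).congr_left fun t => ?_
  noncomm_ring

end EqO

theorem isBigO_one_of_continuous {f : ℝ → A} (hf : Continuous f) :
    f =O[𝓝 0] fun _ => (1 : ℝ) :=
  (hf.tendsto 0).isBigO_one ℝ

theorem isBigO_pow_of_le {n m : ℕ} (hnm : n ≤ m) :
    (fun h : ℝ => h ^ m) =O[𝓝 0] fun h : ℝ => h ^ n := by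
  have h1 : (fun h : ℝ => h ^ (m - n)) =O[𝓝 0] fun _ => (1 : ℝ) :=
    isBigO_one_of_continuous (by fun_prop)
  simpa [← pow_add, Nat.add_sub_cancel' hnm] using
    (isBigO_refl (fun h : ℝ => h ^ n) (𝓝 0)).mul h1

variable [NormedAlgebra ℝ A]

/-- The truncation of a series, evaluated by an algebra homomorphism depending on the step. -/
def evalTrunc (N : ℕ) (φ : ℝ → Free2 →ₐ[ℝ] A) (F : PowerSeries Free2) (h : ℝ) : A :=
  ∑ n ∈ Finset.range N, h ^ n • φ h (PowerSeries.coeff n F)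

variable {N : ℕ} {φ : ℝ → Free2 →ₐ[ℝ] A}

theorem continuous_evalTrunc (hφ : ∀ x, Continuous fun h => φ h x) (F : PowerSeries Free2) :
    Continuous (evalTrunc N φ F) := by
  unfold evalTrunc
  fun_prop

theorem EqTrunc.evalTrunc_eq {F G : PowerSeries Free2} (h : EqTrunc N F G) :
    evalTrunc N φ F = evalTrunc N φ G := by
  funext t
  exact Finset.sum_congr rfl fun n hn => by rw [h n (Finset.mem_range.1 hn)]

/-- The two sides differ by the terms with `i + j ≥ N`, each of which is `h ^ (i + j)` times a
function bounded near `0`. Continuity in `h` is needed because the second generator is later sent to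
a step-dependent operator. -/
theorem evalTrunc_mul (hφ : ∀ x, Continuous fun h => φ h x) (F G : PowerSeries Free2) :
    EqO N (evalTrunc N φ (F * G)) (fun h => evalTrunc N φ F h * evalTrunc N φ G h) := by
  have h1 : ∀ h, evalTrunc N φ (F * G) h = ∑ i ∈ Finset.range N, ∑ j ∈ Finset.range N,
      if i + j < N then h ^ (i + j) • φ h (PowerSeries.coeff i F * PowerSeries.coeff j G)
        else 0 := by
    intro h
    rw [← Finset.sum_product', evalTrunc, ← Finset.sum_filter]
    rw [← Finset.sum_fiberwise_of_maps_to (t := Finset.range N) (g := fun p : ℕ × ℕ => p.1 + p.2)]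
    · refine Finset.sum_congr rfl fun n hn => ?_
      rw [PowerSeries.coeff_mul, map_sum, Finset.smul_sum]
      refine Finset.sum_congr ?_ fun p hp => ?_
      · ext p
        simp only [Finset.HasAntidiagonal.mem_antidiagonal, Finset.mem_filter, Finset.mem_product,
          Finset.mem_range] at hn ⊢
        omega
      · rw [(Finset.mem_filter.1 hp).2]
    · intro p hp
      simpa using (Finset.mem_filter.1 hp).2
  have h2 : ∀ h, evalTrunc N φ F h * evalTrunc N φ G h =
      ∑ i ∈ Finset.range N, ∑ j ∈ Finset.range N,
        h ^ (i + j) • φ h (PowerSeries.coeff i F * PowerSeries.coeff j G) := by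
    intro h
    simp only [evalTrunc, Finset.sum_mul_sum, map_mul, smul_mul_smul_comm, pow_add]
  refine EqO.trans ?_ (EqO.trans (EqO.sum (s := Finset.range N) fun i _ =>
    EqO.sum (s := Finset.range N) (f := fun j h => if i + j < N then
      h ^ (i + j) • φ h (PowerSeries.coeff i F * PowerSeries.coeff j G) else 0)
      (g := fun j h => h ^ (i + j) • φ h (PowerSeries.coeff i F * PowerSeries.coeff j G))
      fun j _ => ?_) ?_)
  · exact EqO.of_eq h1
  · by_cases hij : i + j < N
    · simp only [hij, if_true]
      exact EqO.refl _
    · simp only [hij, if_false, EqO, zero_sub]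
      refine IsBigO.neg_left ?_
      have e1 : (fun h : ℝ => h ^ (i + j))  =O[𝓝 0] fun h : ℝ => h ^ N :=
        isBigO_pow_of_le (by omega)
      simpa using e1.smul (isBigO_one_of_continuous (hφ
        (PowerSeries.coeff i F * PowerSeries.coeff j G)))
  · exact EqO.of_eq fun h => (h2 h).symm

theorem coeff_pow_eq_zero {f : PowerSeries Free2} (hf : PowerSeries.coeff 0 f = 0) {n k : ℕ}
    (hnk : n < k) : PowerSeries.coeff n (f ^ k) = 0 := by
  induction k generalizing n with
  | zero => omega
  | succ k ih =>
    rw [pow_succ, PowerSeries.coeff_mul]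
    refine Finset.sum_eq_zero fun p hp => ?_
    have hpn := Finset.HasAntidiagonal.mem_antidiagonal.1 hp
    by_cases h1 : p.2 = 0
    · rw [h1, hf, mul_zero]
    · rw [ih (by omega), zero_mul]

theorem evalTrunc_pow (hφ : ∀ x, Continuous fun h => φ h x) (F : PowerSeries Free2) (k : ℕ) :
    EqO N (evalTrunc N φ (F ^ k)) (fun h => evalTrunc N φ F h ^ k) := by
  induction k with
  | zero =>
    obtain _ | N := N
    · simpa [EqO, evalTrunc] using isBigO_const_const (-1 : A) (one_ne_zero (α := ℝ)) (𝓝 0)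
    · refine EqO.of_eq fun h => ?_
      simp [evalTrunc, PowerSeries.coeff_one]
  | succ k ih =>
    simp only [pow_succ]
    refine (evalTrunc_mul hφ _ _).trans (ih.mul (EqO.refl _) ?_ ?_)
    · exact isBigO_one_of_continuous (continuous_evalTrunc hφ _)
    · exact isBigO_one_of_continuous (continuous_evalTrunc hφ _)

theorem evalTrunc_isBigO_id (hφ : ∀ x, Continuous fun h => φ h x) {f : PowerSeries Free2}
    (hf : PowerSeries.coeff 0 f = 0) : evalTrunc N φ f =O[𝓝 0] fun h : ℝ => h := by
  unfold evalTrunc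
  refine IsBigO.fun_sum fun n _ => ?_
  obtain _ | n := n
  · simpa [hf] using isBigO_zero _ _
  · have : (fun h : ℝ => h ^ n • φ h (PowerSeries.coeff (n + 1) f)) =O[𝓝 0] fun _ => (1 : ℝ) :=
      isBigO_one_of_continuous (by have := hφ (PowerSeries.coeff (n + 1) f); fun_prop)
    simpa [pow_succ', mul_smul] using (isBigO_refl (fun h : ℝ => h) (𝓝 0)).smul this

theorem exp_eqO_partialSum [CompleteSpace A] {y : ℝ → A} (hy : y =O[𝓝 0] fun h : ℝ => h) (N : ℕ) :
    EqO N (fun h => NormedSpace.exp (y h))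
      (fun h => ∑ k ∈ Finset.range N, ((k.factorial : ℝ)⁻¹) • y h ^ k) := by
  have h1 := (NormedSpace.exp_hasFPowerSeriesAt_zero (𝕂 := ℝ) (𝔸 := A)).isBigO_sub_partialSum_pow N
  have hy0 : Tendsto y (𝓝 0) (𝓝 0) := hy.trans_tendsto tendsto_id
  have h2 := (h1.comp_tendsto hy0).trans (hy.norm_left.pow N)
  refine h2.congr_left fun t => ?_
  simp [FormalMultilinearSeries.partialSum, NormedSpace.expSeries_apply_eq]

/-- Both exponentials are compared with the partial sum of length `N`. The analytic tail is `O(hᴺ)`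
since the argument is `O(h)`; formally, powers `fᵏ` with `k > n` do not reach the coefficient of
`hⁿ`. -/
theorem evalTrunc_formalExp [CompleteSpace A] (hφ : ∀ x, Continuous fun h => φ h x)
    {f : PowerSeries Free2} (hf : PowerSeries.coeff 0 f = 0) :
    EqO N (evalTrunc N φ (formalExp f)) (fun h => NormedSpace.exp (evalTrunc N φ f h)) := by
  refine EqO.trans ?_ (exp_eqO_partialSum (evalTrunc_isBigO_id hφ hf) N).symm
  refine EqO.trans ?_ (EqO.sum fun k _ => (evalTrunc_pow hφ f k).const_smul _)
  refine EqO.of_eq fun h => ?_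
  simp only [evalTrunc, formalExp, PowerSeries.coeff_mk, Finset.smul_sum]
  rw [Finset.sum_comm]
  refine Finset.sum_congr rfl fun n hn => ?_
  rw [map_sum, Finset.smul_sum]
  rw [Finset.mem_range] at hn
  refine (Finset.sum_subset (Finset.range_subset_range.2 (by omega)) fun k _ hk => ?_).trans
    (Finset.sum_congr rfl fun k _ => ?_)
  · rw [Finset.mem_range] at hk
    rw [coeff_pow_eq_zero hf (by omega)]
    simp
  · rw [map_smul, smul_comm]

end
end PHSplitting

namespace PHSplitting
open Asymptotics Topology Filter
noncomputable section

/-! ### Class-a schemes with five stages -/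

theorem coeff_hpow (n k : ℕ) (x : Free2) :
    PowerSeries.coeff n (hpow k x) = if n = k then x else 0 :=
  PowerSeries.coeff_monomial n k x

theorem formalExp_hpow_zero (k : ℕ) : formalExp (hpow k 0) = 1 := by
  ext n
  obtain _ | n := n
  · simp [formalExp, hpow]
  · simp [formalExp, hpow, Finset.sum_range_succ', PowerSeries.coeff_one]

/-- The nine non-trivial factors of a class-a scheme. -/
def nineProd {M : Type*} [Mul M] (p q r s t : M) : M :=
  p * (q * (r * (s * t * s) * r) * q) * p

/-- Since `b₅ = 0`, the tenth factor is `1`; the other nine form a palindrome, bracketed from the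
centre outwards. -/
theorem formalScheme_classA {a b : Fin 5 → ℝ} (h : ClassA a b) :
    formalScheme a b = nineProd (formalExp (hpow 1 (a 0 • gen₁))) (formalExp (hpow 1 (b 0 • gen₂)))
      (formalExp (hpow 1 (a 1 • gen₁))) (formalExp (hpow 1 (b 1 • gen₂)))
      (formalExp (hpow 1 (a 2 • gen₁))) := by
  obtain ⟨ha, hb, hbs⟩ := h
  have e1 : a 3 = a 1 := ha 3
  have e2 : a 4 = a 0 := ha 4
  have e3 : b 4 = 0 := hb 4 rfl
  have e4 : b 2 = b 1 := hbs 2 1 rfl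
  have e5 : b 3 = b 0 := hbs 3 0 rfl
  simp only [formalScheme, List.ofFn_succ, List.ofFn_zero, List.prod_cons, List.prod_nil, nineProd]
  simp [e1, e2, e3, e4, e5, formalExp_hpow_zero, mul_assoc, show Fin.succ (2 : Fin 4) = 3 from rfl]

theorem IsClassASolution.eqTrunc {a b : Fin 5 → ℝ} {e : Coeffs} (h : IsClassASolution a b e) :
    EqTrunc 7 (formalScheme a b) (formalExp e.series) := by
  obtain ⟨r, hr, hs⟩ := h.expansion
  rw [hs]
  refine EqTrunc.formalExp fun n hn => ?_
  rw [map_add, hr n hn, add_zero, Coeffs.series]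

/-! ### Evaluation at step-dependent generators -/

variable {A : Type*} [NormedRing A] [NormedAlgebra ℝ A]

/-- The evaluation of the generators at `X` and `Y h`. -/
def evalAt (X : A) (Y : ℝ → A) (h : ℝ) : Free2 →ₐ[ℝ] A := FreeAlgebra.lift ℝ ![X, Y h]

@[simp] theorem evalAt_gen₁ (X : A) (Y : ℝ → A) (h : ℝ) : evalAt X Y h gen₁ = X := by
  simp [evalAt, gen₁]

@[simp] theorem evalAt_gen₂ (X : A) (Y : ℝ → A) (h : ℝ) : evalAt X Y h gen₂ = Y h := by
  simp [evalAt, gen₂]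

/-- Differentiability, beyond continuity, gives the `O(h)` bound by which the quintic term may be
frozen at `h = 0`. -/
theorem differentiable_evalAt (X : A) {Y : ℝ → A} (hY : Differentiable ℝ Y) (x : Free2) :
    Differentiable ℝ fun h => evalAt X Y h x := by
  induction x using FreeAlgebra.induction with
  | grade0 r => simp
  | grade1 i =>
    fin_cases i
    · simp [evalAt]
    · simpa [evalAt] using hY
  | mul x y hx hy => simpa only [map_mul] using hx.fun_mul hy
  | add x y hx hy => simpa only [map_add] using hx.fun_add hy

theorem continuous_evalAt (X : A) {Y : ℝ → A} (hY : Differentiable ℝ Y) (x : Free2) :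
    Continuous fun h => evalAt X Y h x :=
  (differentiable_evalAt X hY x).continuous

theorem evalTrunc_hpow {N k : ℕ} (hk : k < N) (φ : ℝ → Free2 →ₐ[ℝ] A) (x : Free2) (h : ℝ) :
    evalTrunc N φ (hpow k x) h = h ^ k • φ h x := by
  rw [evalTrunc, Finset.sum_eq_single k]
  · simp [hpow]
  · intro n _ hn
    simp [hpow, PowerSeries.coeff_monomial, hn]
  · intro h
    simp at h
    omega

theorem evalTrunc_add (N : ℕ) (φ : ℝ → Free2 →ₐ[ℝ] A) (F G : PowerSeries Free2) (h : ℝ) :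
    evalTrunc N φ (F + G) h = evalTrunc N φ F h + evalTrunc N φ G h := by
  simp [evalTrunc, Finset.sum_add_distrib]

theorem evalTrunc_mul_eqO {N : ℕ} {φ : ℝ → Free2 →ₐ[ℝ] A} (hφ : ∀ x, Continuous fun h => φ h x)
    {F G : PowerSeries Free2} {f g : ℝ → A} (hF : EqO N (evalTrunc N φ F) f)
    (hG : EqO N (evalTrunc N φ G) g) (hg : Continuous g) :
    EqO N (evalTrunc N φ (F * G)) (fun h => f h * g h) :=
  (evalTrunc_mul hφ F G).trans <| hF.mul hG
    (isBigO_one_of_continuous (continuous_evalTrunc hφ F)) (isBigO_one_of_continuous hg)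

theorem evalTrunc_nineProd {N : ℕ} {φ : ℝ → Free2 →ₐ[ℝ] A}
    (hφ : ∀ x, Continuous fun h => φ h x) {P Q R S T : PowerSeries Free2} {p q r s t : ℝ → A}
    (hP : EqO N (evalTrunc N φ P) p) (hQ : EqO N (evalTrunc N φ Q) q)
    (hR : EqO N (evalTrunc N φ R) r) (hS : EqO N (evalTrunc N φ S) s)
    (hT : EqO N (evalTrunc N φ T) t) (cp : Continuous p) (cq : Continuous q)
    (cr : Continuous r) (cs : Continuous s) (ct : Continuous t) :
    EqO N (evalTrunc N φ (nineProd P Q R S T))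
      (fun h => nineProd (p h) (q h) (r h) (s h) (t h)) := by
  have h1 := evalTrunc_mul_eqO hφ (evalTrunc_mul_eqO hφ hS hT ct) hS cs
  have h2 := evalTrunc_mul_eqO hφ (evalTrunc_mul_eqO hφ hR h1 (by fun_prop)) hR cr
  have h3 := evalTrunc_mul_eqO hφ (evalTrunc_mul_eqO hφ hQ h2 (by fun_prop)) hQ cq
  exact evalTrunc_mul_eqO hφ (evalTrunc_mul_eqO hφ hP h3 (by fun_prop)) hP cp

variable [CompleteSpace A]

theorem exp_eqO {N : ℕ} {u v : ℝ → A} (h : EqO N u v) (hu : Tendsto u (𝓝 0) (𝓝 0))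
    (hv : Tendsto v (𝓝 0) (𝓝 0)) :
    EqO N (fun h => NormedSpace.exp (u h)) (fun h => NormedSpace.exp (v h)) := by
  have h1 := (hasStrictFDerivAt_exp_zero (𝕂 := ℝ) (𝔸 := A)).isBigO_sub
  exact (h1.comp_tendsto (hu.prodMk_nhds hv)).trans h

theorem continuous_exp : Continuous (NormedSpace.exp : A → A) :=
  continuous_iff_continuousAt.2 fun x => (NormedSpace.exp_analytic (𝕂 := ℝ) x).continuousAt

theorem evalTrunc_formalExp_hpow_one {N : ℕ} (hN : 1 < N) {φ : ℝ → Free2 →ₐ[ℝ] A}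
    (hφ : ∀ x, Continuous fun h => φ h x) (c : ℝ) (x : Free2) :
    EqO N (evalTrunc N φ (formalExp (hpow 1 (c • x))))
      (fun h => NormedSpace.exp ((c * h) • φ h x)) := by
  refine (evalTrunc_formalExp hφ (coeff_hpow _ _ _)).trans (EqO.of_eq fun h => ?_)
  rw [evalTrunc_hpow hN, map_smul, smul_smul, pow_one, mul_comm]

/-- The identity is read off from its formal counterpart in two free generators, evaluated at the
constants `T` and `V`. Interactions of `h T` with `h⁵ V` start at `h⁶`. -/
theorem exp_smul_add_pow_five_smul (T V : A) :
    EqO 6 (fun h => NormedSpace.exp (h • T + h ^ 5 • V))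
      (fun h => NormedSpace.exp (h • T) + h ^ 5 • V) := by
  have hφ := continuous_evalAt T (differentiable_const V : Differentiable ℝ fun _ : ℝ => V)
  have h1 : EqTrunc 6 (formalExp (hpow 1 gen₁ + hpow 3 0 + hpow 5 gen₂))
      (formalExp (hpow 1 gen₁) + hpow 5 gen₂) := by
    have := (hasCoeffs_hpow gen₁ 0 gen₂).formalExp
    have h2 := hasCoeffs_formalExp_hpow_one gen₁
    intro n hn
    interval_cases n
    · rw [this.h0, map_add, h2.h0, coeff_hpow]; simp
    · rw [this.h1, map_add, h2.h1, coeff_hpow]; simp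
    · rw [this.h2, map_add, h2.h2, coeff_hpow]; simp
    · rw [this.h3, map_add, h2.h3, coeff_hpow]; simp
    · rw [this.h4, map_add, h2.h4, coeff_hpow]; simp
    · rw [this.h5, map_add, h2.h5, coeff_hpow]; simp [add_comm]
  have h2 := evalTrunc_formalExp (N := 6) hφ (f := hpow 1 gen₁ + hpow 3 0 + hpow 5 gen₂)
    (hasCoeffs_hpow gen₁ 0 gen₂).h0
  have h3 := evalTrunc_formalExp (N := 6) hφ (f := hpow 1 gen₁) (coeff_hpow _ _ _)
  rw [h1.evalTrunc_eq] at h2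
  refine (EqO.of_eq fun h => ?_).trans (h2.symm.trans ?_)
  · simp [evalTrunc_add, evalTrunc_hpow]
  · refine (EqO.of_eq fun h => evalTrunc_add _ _ _ _ h).trans ?_
    exact (h3.add (EqO.refl _)).trans (EqO.of_eq fun h => by simp [evalTrunc_hpow])

end

end PHSplitting

namespace PHSplitting
open Asymptotics Topology Filter
noncomputable section

/-! ### The central factor -/

theorem hasCoeffs_formalExp_hpow_one_add_hpow_four (x w : Free2) :
    HasCoeffs (formalExp (hpow 1 x + hpow 4 w)) 1 x ((1/2 : ℝ) • (x * x))
      ((1/6 : ℝ) • (x * x * x)) (w + (1/24 : ℝ) • (x * x * x * x))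
      ((1/2 : ℝ) • (x * w + w * x) + (1/120 : ℝ) • (x * x * x * x * x))
      ((1/6 : ℝ) • (x * x * w + x * w * x + w * x * x)
        + (1/720 : ℝ) • (x * x * x * x * x * x)) := by
  have h : HasCoeffs (hpow 1 x + hpow 4 w) 0 x 0 0 w 0 0 := by
    constructor <;> rw [map_add, coeff_hpow, coeff_hpow] <;> simp
  have h2 : HasCoeffs ((hpow 1 x + hpow 4 w) ^ 2) 0 0 (x * x) 0 0 (x * w + w * x) 0 := by
    simpa [← pow_two] using h.mul h
  have h3 : HasCoeffs ((hpow 1 x + hpow 4 w) ^ 3) 0 0 0 (x * x * x) 0 0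
      (x * x * w + (x * w + w * x) * x) := by
    simpa [← pow_succ] using h2.mul h
  have h4 : HasCoeffs ((hpow 1 x + hpow 4 w) ^ 4) 0 0 0 0 (x * x * x * x) 0 0 := by
    simpa [← pow_succ] using h3.mul h
  have h5 : HasCoeffs ((hpow 1 x + hpow 4 w) ^ 5) 0 0 0 0 0 (x * x * x * x * x) 0 := by
    simpa [← pow_succ] using h4.mul h
  have h6 : HasCoeffs ((hpow 1 x + hpow 4 w) ^ 6) 0 0 0 0 0 0 (x * x * x * x * x * x) := by
    simpa [← pow_succ] using h5.mul h
  constructor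
  all_goals
    simp only [formalExp, PowerSeries.coeff_mk, Finset.sum_range_succ,
      Finset.sum_range_zero, pow_one, pow_zero, PowerSeries.coeff_one, Nat.factorial,
      h.h1, h.h2, h.h3, h.h4, h.h5, h.h6, h2.h2, h2.h3, h2.h4, h2.h5, h2.h6,
      h3.h3, h3.h4, h3.h5, h3.h6, h4.h4, h4.h5, h4.h6, h5.h5, h5.h6, h6.h6]
    simp
    try (simp only [add_mul, mul_assoc]; module)

theorem HasCoeffs.eqTrunc_six {F G : PowerSeries Free2} {c₀ c₁ c₂ c₃ c₄ c₅ c₆ d₆ : Free2}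
    (hF : HasCoeffs F c₀ c₁ c₂ c₃ c₄ c₅ c₆) (hG : HasCoeffs G c₀ c₁ c₂ c₃ c₄ c₅ d₆) :
    EqTrunc 6 F G := by
  intro n hn
  interval_cases n
  · rw [hF.h0, hG.h0]
  · rw [hF.h1, hG.h1]
  · rw [hF.h2, hG.h2]
  · rw [hF.h3, hG.h3]
  · rw [hF.h4, hG.h4]
  · rw [hF.h5, hG.h5]

theorem hasCoeffs_formalExp_hpow_one_add_hpow_five (x v : Free2) :
    HasCoeffs (formalExp (hpow 1 x) + hpow 5 v) 1 x ((1/2 : ℝ) • (x * x)) ((1/6 : ℝ) • (x * x * x))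
      ((1/24 : ℝ) • (x * x * x * x)) ((1/120 : ℝ) • (x * x * x * x * x) + v)
      ((1/720 : ℝ) • (x * x * x * x * x * x)) := by
  have h := hasCoeffs_formalExp_hpow_one x
  constructor <;> rw [map_add, coeff_hpow]
  · rw [h.h0]; simp
  · rw [h.h1]; simp
  · rw [h.h2]; simp
  · rw [h.h3]; simp
  · rw [h.h4]; simp
  · rw [h.h5]; simp
  · rw [h.h6]; simp

/-- The contributions of `w` and `-w` cancel at `h⁴`. At `h⁵` the symmetrised terms cancel too, and
the cross terms `w x - x w` remain. -/
theorem eqTrunc_middleI (x w : Free2) :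
    EqTrunc 6 (formalExp (hpow 1 x + hpow 4 w) * formalExp (hpow 1 x + hpow 4 (-w)))
      (formalExp (hpow 1 ((2 : ℝ) • x)) + hpow 5 ⁅w, x⁆) := by
  refine HasCoeffs.eqTrunc_six
    (((hasCoeffs_formalExp_hpow_one_add_hpow_four x w).mul
      (hasCoeffs_formalExp_hpow_one_add_hpow_four x (-w))).congr ?_ ?_ ?_ ?_ ?_ ?_ rfl)
    (hasCoeffs_formalExp_hpow_one_add_hpow_five _ _)
  all_goals
    simp only [Ring.lie_def, mul_add, add_mul, smul_mul_assoc, mul_smul_comm, mul_assoc, mul_one,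
      one_mul, mul_neg, neg_mul]
    try module

/-- Conjugation by `exp (h⁴ w)` changes `exp (h x)` to leading order by the commutator of `h⁴ w`
with `h x`. -/
theorem eqTrunc_middleII (x w : Free2) :
    EqTrunc 6 (formalExp (hpow 1 0 + hpow 4 w) * formalExp (hpow 1 x) *
        formalExp (hpow 1 0 + hpow 4 (-w)))
      (formalExp (hpow 1 x) + hpow 5 ⁅w, x⁆) := by
  refine HasCoeffs.eqTrunc_six
    ((((hasCoeffs_formalExp_hpow_one_add_hpow_four 0 w).mul
      (hasCoeffs_formalExp_hpow_one x)).mul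
      (hasCoeffs_formalExp_hpow_one_add_hpow_four 0 (-w))).congr ?_ ?_ ?_ ?_ ?_ ?_ rfl)
    (hasCoeffs_formalExp_hpow_one_add_hpow_five _ _)
  all_goals
    simp [Ring.lie_def, mul_assoc]
    try module

variable {A : Type*} [NormedRing A] [NormedAlgebra ℝ A] [CompleteSpace A]

theorem middleI_eqO (p q : A) :
    EqO 6 (fun h => NormedSpace.exp (h • p + h ^ 4 • q) * NormedSpace.exp (h • p - h ^ 4 • q))
      (fun h => NormedSpace.exp ((2 * h) • p) + h ^ 5 • ⁅q, p⁆) := by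
  have hφ := continuous_evalAt p (differentiable_const q : Differentiable ℝ fun _ : ℝ => q)
  have h1 := evalTrunc_formalExp (N := 6) hφ (f := hpow 1 gen₁ + hpow 4 gen₂)
    (by rw [map_add, coeff_hpow, coeff_hpow]; simp)
  have h2 := evalTrunc_formalExp (N := 6) hφ (f := hpow 1 gen₁ + hpow 4 (-gen₂))
    (by rw [map_add, coeff_hpow, coeff_hpow]; simp)
  have h3 := evalTrunc_mul_eqO hφ h1 h2
    (continuous_exp.comp (continuous_evalTrunc hφ _))
  rw [(eqTrunc_middleI _ _).evalTrunc_eq] at h3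
  have h4 := (evalTrunc_formalExp_hpow_one (N := 6) (by norm_num) hφ 2 gen₁).add
    (EqO.refl (evalTrunc 6 (evalAt p fun _ => q) (hpow 5 ⁅gen₂, gen₁⁆)))
  refine (EqO.of_eq fun h => ?_).trans
    (h3.symm.trans ((EqO.of_eq fun h => evalTrunc_add _ _ _ _ h).trans
      (h4.trans (EqO.of_eq fun h => ?_))))
  · simp [evalTrunc_add, evalTrunc_hpow, sub_eq_add_neg]
  · simp [evalTrunc_hpow, Ring.lie_def]

theorem middleII_eqO (p q : A) :
    EqO 6 (fun h => NormedSpace.exp (h ^ 4 • q) * NormedSpace.exp (h • p) *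
        NormedSpace.exp (-(h ^ 4 • q)))
      (fun h => NormedSpace.exp (h • p) + h ^ 5 • ⁅q, p⁆) := by
  have hφ := continuous_evalAt p (differentiable_const q : Differentiable ℝ fun _ : ℝ => q)
  have h1 := evalTrunc_formalExp (N := 6) hφ (f := hpow 1 0 + hpow 4 gen₂)
    (by rw [map_add, coeff_hpow, coeff_hpow]; simp)
  have h2 := evalTrunc_formalExp (N := 6) hφ (f := hpow 1 0 + hpow 4 (-gen₂))
    (by rw [map_add, coeff_hpow, coeff_hpow]; simp)
  have h0 := evalTrunc_formalExp (N := 6) hφ (f := hpow 1 gen₁) (coeff_hpow _ _ _)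
  have h3 := evalTrunc_mul_eqO hφ (evalTrunc_mul_eqO hφ h1 h0
    (continuous_exp.comp (continuous_evalTrunc hφ _))) h2
    (continuous_exp.comp (continuous_evalTrunc hφ _))
  rw [(eqTrunc_middleII _ _).evalTrunc_eq] at h3
  have h4 := h0.add (EqO.refl (evalTrunc 6 (evalAt p fun _ => q) (hpow 5 ⁅gen₂, gen₁⁆)))
  refine (EqO.of_eq fun h => ?_).trans
    (h3.symm.trans ((EqO.of_eq fun h => evalTrunc_add _ _ _ _ h).trans
      (h4.trans (EqO.of_eq fun h => ?_))))
  · simp [evalTrunc_add, evalTrunc_hpow]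
  · simp [evalTrunc_hpow, Ring.lie_def]

/-! ### The composition -/

/-- The modified second operator `L₂ - c h² C - h⁴ Z`. -/
def modL₂ (e : Coeffs) (L₁ L₂ : A) (h : ℝ) : A :=
  L₂ - (e.e31 * h ^ 2) • commC L₁ L₂ - h ^ 4 • (e.e51t • ⁅L₁, ⁅L₁, commC L₁ L₂⁆⁆ +
    e.e53 • ⁅L₁, ⁅L₂, commD L₁ L₂⁆⁆ + e.e55 • ⁅L₂, ⁅L₂, commC L₁ L₂⁆⁆)

omit [CompleteSpace A] in
theorem differentiable_modL₂ (e : Coeffs) (L₁ L₂ : A) : Differentiable ℝ (modL₂ e L₁ L₂) := by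
  unfold modL₂
  fun_prop

-- This is the cancellation that dictates the modified operator. The term `-c h³ C` removes the
-- cubic term, whose own modification yields `-c² h⁵ [L₁,[L₁,C]]`; together with `-h⁵ Z` only the
-- `e₅₂` bracket survives. The discarded terms are the variation of the quintic bracket with `h` and
-- one multiple of `h⁷`.
omit [CompleteSpace A] in
theorem evalTrunc_series_eqO {e : Coeffs} (h11 : e.e11 = 1) (h12 : e.e12 = 1) (h32 : e.e32 = 0)
    (h54 : e.e54 = 0) (h56 : e.e56 = 0) (L₁ L₂ : A) :
    EqO 6 (evalTrunc 6 (evalAt L₁ (modL₂ e L₁ L₂)) e.series)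
      (fun h => h • (L₁ + L₂) + h ^ 5 • e.e52 • ⁅L₁, ⁅L₁, commD L₁ L₂⁆⁆) := by
  set Z := e.e51t • ⁅L₁, ⁅L₁, commC L₁ L₂⁆⁆ +
    e.e53 • ⁅L₁, ⁅L₂, commD L₁ L₂⁆⁆ + e.e55 • ⁅L₂, ⁅L₂, commC L₁ L₂⁆⁆ with hZ
  have hd := differentiable_evalAt L₁ (differentiable_modL₂ e L₁ L₂) e.term5
  have h1 : (fun h => evalAt L₁ (modL₂ e L₁ L₂) h e.term5 - evalAt L₁ (modL₂ e L₁ L₂) 0 e.term5)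
      =O[𝓝 0] fun h : ℝ => h := by
    simpa using (hd 0).isBigO_sub
  have h2 : (fun h : ℝ => h ^ 5 • (evalAt L₁ (modL₂ e L₁ L₂) h e.term5
      - evalAt L₁ (modL₂ e L₁ L₂) 0 e.term5)) =O[𝓝 0] fun h : ℝ => h ^ 6 := by
    exact ((isBigO_refl (fun h : ℝ => h ^ 5) (𝓝 0)).smul h1).congr_right fun h => by
      rw [smul_eq_mul]
      ring
  have h3 : (fun h : ℝ => h ^ 7 • (e.e31 • ⁅L₁, ⁅L₁, Z⁆⁆)) =O[𝓝 0] fun h : ℝ => h ^ 6 := by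
    simpa using (isBigO_pow_of_le (show 6 ≤ 7 by norm_num)).smul
      (isBigO_one_of_continuous (continuous_const (y := e.e31 • ⁅L₁, ⁅L₁, Z⁆⁆)))
  have hL : ∀ h, modL₂ e L₁ L₂ h = L₂ - (e.e31 * h ^ 2) • commC L₁ L₂ - h ^ 4 • Z := fun h => rfl
  have h5 : evalAt L₁ (modL₂ e L₁ L₂) 0 e.term5 =
      Z + e.e31 ^ 2 • ⁅L₁, ⁅L₁, commC L₁ L₂⁆⁆ + e.e52 • ⁅L₁, ⁅L₁, commD L₁ L₂⁆⁆ := by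
    have e0 : modL₂ e L₁ L₂ 0 = L₂ := by simp [hL]
    simp only [Coeffs.term5, h54, h56, zero_smul, add_zero, map_add, map_smul, commC, commD,
      Ring.lie_def, map_sub, map_mul, evalAt_gen₁, evalAt_gen₂, e0, hZ, Coeffs.e51t]
    module
  refine (h2.sub h3).congr_left fun h => ?_
  rw [h5, Coeffs.series, evalTrunc_add, evalTrunc_add, evalTrunc_hpow (by norm_num),
    evalTrunc_hpow (by norm_num), evalTrunc_hpow (by norm_num)]
  generalize evalAt L₁ (modL₂ e L₁ L₂) h e.term5 = K
  simp only [Coeffs.term1, Coeffs.term3, h11, h12, h32, zero_smul, add_zero, map_add, map_smul,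
    commC, Ring.lie_def, map_sub, map_mul, evalAt_gen₁, evalAt_gen₂, hL, mul_sub, sub_mul,
    smul_mul_assoc, mul_smul_comm, mul_assoc]
  generalize Z = Z'
  module

omit [CompleteSpace A] in
theorem continuous_modL₂ (e : Coeffs) (L₁ L₂ : A) : Continuous (modL₂ e L₁ L₂) :=
  (differentiable_modL₂ e L₁ L₂).continuous

omit [NormedAlgebra ℝ A] [CompleteSpace A] in
theorem tendsto_zero_of_continuous {f : ℝ → A} (hf : Continuous f) (h0 : f 0 = 0) :
    Tendsto f (𝓝 0) (𝓝 0) :=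
  h0 ▸ hf.tendsto 0

/-- The unmodified composition, up to `O(h⁶)`. -/
theorem nineProd_exp_eqO {a b : Fin 5 → ℝ} {e : Coeffs} (he : IsClassASolution a b e)
    (L₁ L₂ : A) :
    EqO 6 (fun h => nineProd (NormedSpace.exp ((a 0 * h) • L₁))
        (NormedSpace.exp ((b 0 * h) • modL₂ e L₁ L₂ h)) (NormedSpace.exp ((a 1 * h) • L₁))
        (NormedSpace.exp ((b 1 * h) • modL₂ e L₁ L₂ h)) (NormedSpace.exp ((a 2 * h) • L₁)))
      (fun h => NormedSpace.exp (h • (L₁ + L₂)) + h ^ 5 • e.e52 • ⁅L₁, ⁅L₁, commD L₁ L₂⁆⁆) := by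
  have hφ := continuous_evalAt L₁ (differentiable_modL₂ e L₁ L₂)
  have hL := continuous_modL₂ e L₁ L₂
  have hX : ∀ c : ℝ, EqO 6 (evalTrunc 6 (evalAt L₁ (modL₂ e L₁ L₂)) (formalExp (hpow 1 (c • gen₁))))
      (fun h => NormedSpace.exp ((c * h) • L₁)) := fun c =>
    (evalTrunc_formalExp_hpow_one (by norm_num) hφ c gen₁).trans (EqO.of_eq fun h => by simp)
  have hY : ∀ c : ℝ, EqO 6 (evalTrunc 6 (evalAt L₁ (modL₂ e L₁ L₂)) (formalExp (hpow 1 (c • gen₂))))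
      (fun h => NormedSpace.exp ((c * h) • modL₂ e L₁ L₂ h)) := fun c =>
    (evalTrunc_formalExp_hpow_one (by norm_num) hφ c gen₂).trans (EqO.of_eq fun h => by simp)
  have cX : ∀ c : ℝ, Continuous fun h : ℝ => NormedSpace.exp ((c * h) • L₁) := fun c =>
    continuous_exp.comp (by fun_prop)
  have cY : ∀ c : ℝ, Continuous fun h : ℝ => NormedSpace.exp ((c * h) • modL₂ e L₁ L₂ h) :=
    fun c => continuous_exp.comp (by fun_prop)
  have h1 := evalTrunc_nineProd hφ (hX (a 0)) (hY (b 0)) (hX (a 1)) (hY (b 1)) (hX (a 2))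
    (cX _) (cY _) (cX _) (cY _) (cX _)
  have h2 : EqTrunc 6 (formalScheme a b) (formalExp e.series) :=
    fun n hn => he.eqTrunc n (by omega)
  rw [← formalScheme_classA he.classA, h2.evalTrunc_eq] at h1
  have h0 : PowerSeries.coeff 0 e.series = 0 := (hasCoeffs_hpow _ _ _).h0
  refine h1.symm.trans ((evalTrunc_formalExp hφ h0).trans ?_)
  refine (exp_eqO (evalTrunc_series_eqO he.e11_eq he.e12_eq he.e32_eq he.e54_eq he.e56_eq L₁ L₂)
    ((evalTrunc_isBigO_id hφ h0).trans_tendsto tendsto_id)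
    (tendsto_zero_of_continuous (by fun_prop) (by simp))).trans ?_
  exact exp_smul_add_pow_five_smul _ _

theorem exp_eqO_one {y : ℝ → A} (hy : y =O[𝓝 0] fun h : ℝ => h) :
    EqO 1 (fun h => NormedSpace.exp (y h)) (fun _ => 1) :=
  (exp_eqO_partialSum hy 1).trans (EqO.of_eq fun h => by simp)

omit [NormedAlgebra ℝ A] [CompleteSpace A] in
theorem nineProd_eqO {N : ℕ} {p q r s t p' q' r' s' t' : ℝ → A} (hp : EqO N p p')
    (hq : EqO N q q') (hr : EqO N r r') (hs : EqO N s s') (ht : EqO N t t')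
    (cp : Continuous p) (cp' : Continuous p') (cq : Continuous q) (cq' : Continuous q')
    (cr : Continuous r) (cr' : Continuous r') (cs : Continuous s) (cs' : Continuous s')
    (ct : Continuous t) (ct' : Continuous t') :
    EqO N (fun h => nineProd (p h) (q h) (r h) (s h) (t h))
      (fun h => nineProd (p' h) (q' h) (r' h) (s' h) (t' h)) := by
  have key : ∀ {f f' g g' : ℝ → A}, EqO N f f' → EqO N g g' → Continuous f → Continuous f' →
      Continuous g → Continuous g' →
      EqO N (fun h => f h * g h * f h) (fun h => f' h * g' h * f' h) := by
    intro f f' g g' hf hg cf cf' cg cg'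
    exact (hf.mul hg (isBigO_one_of_continuous cf) (isBigO_one_of_continuous cg')).mul hf
      (isBigO_one_of_continuous (by fun_prop)) (isBigO_one_of_continuous (by fun_prop))
  have h1 := key hs ht cs cs' ct ct'
  have h2 := key hr h1 cr cr' (by fun_prop) (by fun_prop)
  have h3 := key hq h2 cq cq' (by fun_prop) (by fun_prop)
  exact key hp h3 cp cp' (by fun_prop) (by fun_prop)

/-- The composition with a central factor that cancels the remaining quintic term. -/
theorem nineProd_middle_eqO {a b : Fin 5 → ℝ} {e : Coeffs} (he : IsClassASolution a b e)
    (L₁ L₂ : A) {S : ℝ → A} (cS : Continuous S)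
    (hS : EqO 6 S (fun h => NormedSpace.exp ((a 2 * h) • L₁)
      - h ^ 5 • e.e52 • ⁅L₁, ⁅L₁, commD L₁ L₂⁆⁆)) :
    EqO 6 (fun h => nineProd (NormedSpace.exp ((a 0 * h) • L₁))
        (NormedSpace.exp ((b 0 * h) • modL₂ e L₁ L₂ h)) (NormedSpace.exp ((a 1 * h) • L₁))
        (NormedSpace.exp ((b 1 * h) • modL₂ e L₁ L₂ h)) (S h))
      (fun h => NormedSpace.exp (h • (L₁ + L₂))) := by
  set W := e.e52 • ⁅L₁, ⁅L₁, commD L₁ L₂⁆⁆ with hW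
  have hL := continuous_modL₂ e L₁ L₂
  have cX : ∀ c : ℝ, Continuous fun h : ℝ => NormedSpace.exp ((c * h) • L₁) := fun c =>
    continuous_exp.comp (by fun_prop)
  have cY : ∀ c : ℝ, Continuous fun h : ℝ => NormedSpace.exp ((c * h) • modL₂ e L₁ L₂ h) :=
    fun c => continuous_exp.comp (by fun_prop)
  have oX : ∀ c : ℝ, EqO 1 (fun h : ℝ => NormedSpace.exp ((c * h) • L₁)) (fun _ => 1) := by
    intro c
    refine exp_eqO_one ?_
    simpa using ((isBigO_refl (fun h : ℝ => h) (𝓝 0)).const_mul_left c).smul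
      (isBigO_one_of_continuous (continuous_const (y := L₁)))
  have oY : ∀ c : ℝ, EqO 1 (fun h : ℝ => NormedSpace.exp ((c * h) • modL₂ e L₁ L₂ h))
      (fun _ => 1) := by
    intro c
    refine exp_eqO_one ?_
    simpa using ((isBigO_refl (fun h : ℝ => h) (𝓝 0)).const_mul_left c).smul
      (isBigO_one_of_continuous hL)
  have h1 := nineProd_eqO (EqO.refl _) (EqO.refl _) (EqO.refl _) (EqO.refl _) hS
    (cX (a 0)) (cX (a 0)) (cY (b 0)) (cY (b 0)) (cX (a 1)) (cX (a 1)) (cY (b 1)) (cY (b 1))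
    cS ((cX (a 2)).sub (by fun_prop))
  have h2 := nineProd_eqO (oX (a 0)) (oY (b 0)) (oX (a 1)) (oY (b 1)) (EqO.refl fun _ => W)
    (cX _) continuous_const (cY _) continuous_const (cX _) continuous_const (cY _)
    continuous_const continuous_const continuous_const
  -- The outer factors are `1 + O(h)`, so with the prefactor `h⁵` they may be dropped. As `nineProd`
  -- is linear in its central argument, this isolates the effect of the correction in `S`.
  have h3 : EqO 6 (fun h => h ^ 5 • nineProd (NormedSpace.exp ((a 0 * h) • L₁))
        (NormedSpace.exp ((b 0 * h) • modL₂ e L₁ L₂ h)) (NormedSpace.exp ((a 1 * h) • L₁))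
        (NormedSpace.exp ((b 1 * h) • modL₂ e L₁ L₂ h)) W) (fun h => h ^ 5 • W) := by
    refine ((isBigO_refl (fun h : ℝ => h ^ 5) (𝓝 0)).smul h2).congr (fun h => ?_) fun h => ?_
    · simp [nineProd, smul_sub]
    · rw [smul_eq_mul]
      ring
  refine h1.trans ?_
  have h4 := IsBigO.sub (nineProd_exp_eqO he L₁ L₂) h3
  refine h4.congr_left fun h => ?_
  simp only [nineProd, mul_sub, sub_mul, mul_smul_comm, smul_mul_assoc]
  abel

end

end PHSplitting

/-! ### The order gained from symmetry, and errors moved into the exponent. -/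

namespace PHSplitting
open Asymptotics Topology Filter
noncomputable section

variable {A : Type*} [NormedRing A] [NormedAlgebra ℝ A]

theorem eq_zero_of_smul_isBigO {g : ℝ → A} (hg : ContinuousAt g 0) {n : ℕ}
    (h : (fun t : ℝ => t ^ n • g t) =O[𝓝 0] fun t : ℝ => t ^ (n + 1)) : g 0 = 0 := by
  have h1 : g =O[𝓝[≠] 0] fun t : ℝ => t := by
    have h2 := ((isBigO_refl (fun t : ℝ => (t ^ n)⁻¹) (𝓝[≠] 0)).smul
      (h.mono nhdsWithin_le_nhds))
    refine h2.congr' ?_ ?_ <;> filter_upwards [self_mem_nhdsWithin] with t ht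
    · rw [smul_smul, inv_mul_cancel₀ (pow_ne_zero _ ht), one_smul]
    · rw [smul_eq_mul, pow_succ, inv_mul_cancel_left₀ (pow_ne_zero _ ht)]
  have h3 : Tendsto g (𝓝[≠] 0) (𝓝 0) := h1.trans_tendsto (tendsto_id.mono_left nhdsWithin_le_nhds)
  exact tendsto_nhds_unique (hg.mono_left nhdsWithin_le_nhds) h3

/-- Factors of `t` are split off one at a time: the decay forces the current quotient to vanish at
`0`, and analyticity lets another factor be removed. -/
theorem exists_analyticAt_eq_pow_smul {f : ℝ → A} (hf : AnalyticAt ℝ f 0) {n : ℕ}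
    (h : f =O[𝓝 0] fun t : ℝ => t ^ n) :
    ∃ g : ℝ → A, AnalyticAt ℝ g 0 ∧ ∀ᶠ t in 𝓝 0, f t = t ^ n • g t := by
  induction n with
  | zero => exact ⟨f, hf, by simp⟩
  | succ n ih =>
    obtain ⟨g, hg, hfg⟩ := ih (h.trans (isBigO_pow_of_le n.le_succ))
    have h0 : g 0 = 0 := eq_zero_of_smul_isBigO hg.continuousAt (h.congr' hfg EventuallyEq.rfl)
    have h1 : ((1 : ℕ) : ℕ∞) ≤ analyticOrderAt g 0 := by
      rw [Nat.cast_one, Order.one_le_iff_ne_zero, analyticOrderAt_ne_zero]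
      exact ⟨hg, h0⟩
    obtain ⟨k, hk, hgk⟩ := (natCast_le_analyticOrderAt hg).1 h1
    refine ⟨k, hk, ?_⟩
    filter_upwards [hfg, hgk] with t h2 h3
    rw [h2, h3, smul_smul, sub_zero, pow_one, pow_succ]

/-- The difference of two analytic symmetric methods vanishes to odd order. -/
theorem EqO.succ_of_symmetric {n : ℕ} (hn : Even n) (hn0 : n ≠ 0) {Φ Ψ : ℝ → A}
    (hΦ : AnalyticAt ℝ Φ 0) (hΨ : AnalyticAt ℝ Ψ 0) (h : EqO n Φ Ψ) (hΨ0 : Ψ 0 = 1)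
    (sΦ : ∀ t, Φ t * Φ (-t) = 1) (sΨ : ∀ t, Ψ t * Ψ (-t) = 1) : EqO (n + 1) Φ Ψ := by
  obtain ⟨g, hg, hfg⟩ := exists_analyticAt_eq_pow_smul (hΦ.sub hΨ) h
  have hneg : Tendsto (fun t : ℝ => -t) (𝓝 0) (𝓝 0) := by simpa using tendsto_neg (0 : ℝ)
  have hfg' := hneg.eventually hfg
  have cg : ContinuousAt (fun t => g (-t)) 0 :=
    ContinuousAt.comp (g := g) (by simpa using hg.continuousAt) continuousAt_neg
  have cΨ : ContinuousAt (fun t => Ψ (-t)) 0 :=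
    ContinuousAt.comp (g := Ψ) (by simpa using hΨ.continuousAt) continuousAt_neg
  -- With `Φ = Ψ + tⁿ g` and `n` even, subtracting the two symmetry relations leaves `tⁿ k(t) = 0`
  -- near `0`. Hence `k(0) = 2 g(0)` vanishes, using `Ψ(0) = 1` and `n ≠ 0`.
  set k : ℝ → A := fun t => g t * Ψ (-t) + Ψ t * g (-t) + t ^ n • (g t * g (-t)) with hk
  have ck : ContinuousAt k 0 := by
    have h1 := hg.continuousAt
    have h2 := hΨ.continuousAt
    exact ((h1.mul cΨ).add (h2.mul cg)).add ((continuousAt_id.pow n).smul (h1.mul cg))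
  have hk0 : k 0 = 0 := by
    refine eq_zero_of_smul_isBigO ck (n := n)
      ((isBigO_zero _ _).congr' ?_ EventuallyEq.rfl (f₁ := fun _ => (0 : A)))
    filter_upwards [hfg, hfg'] with t h1 h2
    have e1 : Φ t = Ψ t + t ^ n • g t := by rw [← h1]; simp
    have e2 : Φ (-t) = Ψ (-t) + t ^ n • g (-t) := by
      rw [← hn.neg_pow t, ← h2]; simp
    have e3 := sΦ t
    rw [e1, e2, add_mul, mul_add, mul_add, sΨ, smul_mul_smul_comm] at e3
    simp only [hk]
    rw [smul_add, smul_add, smul_smul, ← smul_mul_assoc, ← mul_smul_comm, eq_comm,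
      ← sub_eq_zero.2 e3]
    abel
  have hg0 : g 0 = 0 := by
    have : k 0 = (2 : ℝ) • g 0 := by simp [hk, hΨ0, hn0, two_smul]
    rw [this] at hk0
    simpa using hk0
  have h1 : g =O[𝓝 0] fun t : ℝ => t := by
    simpa [hg0] using hg.differentiableAt.isBigO_sub
  refine ((isBigO_refl (fun t : ℝ => t ^ n) (𝓝 0)).smul h1).congr' ?_ ?_
  · filter_upwards [hfg] with t ht
    rw [← ht]; simp
  · exact Eventually.of_forall fun t => by simp [pow_succ]

variable [CompleteSpace A]

/-- Methods that agree up to `O(hᴺ)` with an exponential are exponentials up to `O(hᴺ)`. -/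
theorem exists_exp_eq_of_eqO {N : ℕ} {Φ u : ℝ → A} (hu : Tendsto u (𝓝 0) (𝓝 0)) (hN : N ≠ 0)
    (h : EqO N Φ (fun t => NormedSpace.exp (u t))) :
    ∃ E : ℝ → A, E =O[𝓝 0] (fun t : ℝ => t ^ N) ∧
      ∀ᶠ t in 𝓝 0, Φ t = NormedSpace.exp (u t + E t) := by
  -- The derivative of `exp` at `0` is the identity, so a local logarithm exists. Its local
  -- Lipschitz bound transfers the `O(tᴺ)` estimate to the exponents.
  have hs : HasStrictFDerivAt (NormedSpace.exp : A → A)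
      ((ContinuousLinearEquiv.refl ℝ A : A ≃L[ℝ] A) : A →L[ℝ] A) 0 := hasStrictFDerivAt_exp_zero
  have hl := hs.to_localInverse.isBigO_sub
  have hr := hs.eventually_right_inverse
  have hli := hs.eventually_left_inverse
  rw [NormedSpace.exp_zero] at hl hr
  have he : Tendsto (fun t => NormedSpace.exp (u t)) (𝓝 0) (𝓝 1) := by
    simpa [Function.comp_def] using ((continuous_exp (A := A)).tendsto 0).comp hu
  have hΦ : Tendsto Φ (𝓝 0) (𝓝 1) := by
    have h1 : Tendsto (fun t => Φ t - NormedSpace.exp (u t)) (𝓝 0) (𝓝 0) := by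
      refine h.trans_tendsto ?_
      have := (continuous_pow N (M := ℝ)).tendsto 0
      simpa [hN] using this
    simpa using h1.add he
  refine ⟨fun t => hs.localInverse _ _ _ (Φ t) - u t, ?_, ?_⟩
  · refine ((hl.comp_tendsto (hΦ.prodMk_nhds he)).trans h).congr' ?_ EventuallyEq.rfl
    filter_upwards [hu.eventually hli] with t ht
    simp only [Function.comp_apply]
    rw [ht]
  · filter_upwards [hΦ.eventually hr] with t ht
    rw [add_sub_cancel, ht]

end

end PHSplitting

/-! ### Matrices: symmetry, order and dissipation of both methods. -/

namespace PHSplitting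
open Asymptotics Topology Filter Matrix
noncomputable section

section
variable {A : Type*} [NormedRing A] [NormedAlgebra ℝ A] [CompleteSpace A]

theorem exp_mul_exp_neg (x : A) : NormedSpace.exp x * NormedSpace.exp (-x) = 1 := by
  let _ := NormedAlgebra.restrictScalars ℚ ℝ A
  rw [← NormedSpace.exp_add_of_commute (Commute.neg_right (Commute.refl x)), add_neg_cancel,
    NormedSpace.exp_zero]

theorem nineProd_mul_eq_one {M : Type*} [Monoid M] {p q r s t p' q' r' s' t' : M}
    (hp : p * p' = 1) (hq : q * q' = 1) (hr : r * r' = 1) (hs : s * s' = 1) (ht : t * t' = 1) :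
    nineProd p q r s t * nineProd p' q' r' s' t' = 1 := by
  have key : ∀ {f f' g g' : M}, f * f' = 1 → g * g' = 1 → f * g * f * (f' * g' * f') = 1 := by
    intro f f' g g' hf hg
    calc f * g * f * (f' * g' * f') = f * (g * (f * f') * g') * f' := by simp only [mul_assoc]
      _ = 1 := by rw [hf, mul_one, hg, mul_one, hf]
  exact key hp (key hq (key hr (key hs ht)))

theorem analyticAt_exp_comp {f : ℝ → A} {x : ℝ} (hf : AnalyticAt ℝ f x) :
    AnalyticAt ℝ (fun h => NormedSpace.exp (f h)) x :=
  (NormedSpace.exp_analytic (𝕂 := ℝ) (f x)).comp hf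

/-- The composition with a symmetric analytic central factor. -/
theorem exists_nineProd_eq_exp {a b : Fin 5 → ℝ} {e : Coeffs} (he : IsClassASolution a b e)
    (L₁ L₂ : A) {S : ℝ → A} (aS : AnalyticAt ℝ S 0) (cS : Continuous S)
    (sS : ∀ h, S h * S (-h) = 1)
    (hS : EqO 6 S (fun h => NormedSpace.exp ((a 2 * h) • L₁)
      - h ^ 5 • e.e52 • ⁅L₁, ⁅L₁, commD L₁ L₂⁆⁆)) :
    ∃ E : ℝ → A, E =O[𝓝 0] (fun h : ℝ => h ^ 7) ∧
      ∀ᶠ h in 𝓝 0, nineProd (NormedSpace.exp ((a 0 * h) • L₁))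
        (NormedSpace.exp ((b 0 * h) • modL₂ e L₁ L₂ h)) (NormedSpace.exp ((a 1 * h) • L₁))
        (NormedSpace.exp ((b 1 * h) • modL₂ e L₁ L₂ h)) (S h)
        = NormedSpace.exp (h • (L₁ + L₂) + E h) := by
  have aX : ∀ c : ℝ, AnalyticAt ℝ (fun h : ℝ => NormedSpace.exp ((c * h) • L₁)) 0 := fun c =>
    analyticAt_exp_comp (by fun_prop)
  have aL : AnalyticAt ℝ (modL₂ e L₁ L₂) 0 := by
    unfold modL₂
    fun_prop
  have aY : ∀ c : ℝ, AnalyticAt ℝ (fun h : ℝ => NormedSpace.exp ((c * h) • modL₂ e L₁ L₂ h)) 0 :=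
    fun c => analyticAt_exp_comp (by fun_prop)
  have aT : AnalyticAt ℝ (fun h : ℝ => NormedSpace.exp (h • (L₁ + L₂))) 0 :=
    analyticAt_exp_comp (by fun_prop)
  have sX : ∀ c h : ℝ, NormedSpace.exp ((c * h) • L₁) * NormedSpace.exp ((c * -h) • L₁) = 1 := by
    intro c h
    rw [mul_neg, neg_smul, exp_mul_exp_neg]
  have sY : ∀ c h : ℝ, NormedSpace.exp ((c * h) • modL₂ e L₁ L₂ h) *
      NormedSpace.exp ((c * -h) • modL₂ e L₁ L₂ (-h)) = 1 := by
    intro c h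
    have : modL₂ e L₁ L₂ (-h) = modL₂ e L₁ L₂ h := by
      simp only [modL₂, (by decide : Even 2).neg_pow, (by decide : Even 4).neg_pow]
    rw [this, mul_neg, neg_smul, exp_mul_exp_neg]
  refine exists_exp_eq_of_eqO (tendsto_zero_of_continuous (by fun_prop) (by simp)) (by norm_num) ?_
  refine (nineProd_middle_eqO he L₁ L₂ cS hS).succ_of_symmetric (by decide) (by norm_num) ?_ aT
    (by simp) (fun h => nineProd_mul_eq_one (sX _ _) (sY _ _) (sX _ _) (sY _ _) (sS h)) fun h => ?_
  · have h1 := aX (a 0)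
    have h2 := aX (a 1)
    have h3 := aY (b 0)
    have h4 := aY (b 1)
    unfold nineProd
    fun_prop
  · rw [neg_smul, exp_mul_exp_neg]
end

variable {n : ℕ}

theorem step_eq_nineProd (a b : Fin 5 → ℝ) (e : Coeffs) (L₁ L₂ : Matrix (Fin n) (Fin n) ℝ)
    (S : ℝ → Matrix (Fin n) (Fin n) ℝ) (h : ℝ) :
    step a b e L₁ L₂ S h = nineProd (NormedSpace.exp ((a 0 * h) • L₁))
      (NormedSpace.exp ((b 0 * h) • matLcz e L₁ L₂ h)) (NormedSpace.exp ((a 1 * h) • L₁))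
      (NormedSpace.exp ((b 1 * h) • matLcz e L₁ L₂ h)) (S h) := by
  simp only [step, nineProd, mul_assoc]

theorem matrix_exp_mul_exp_neg (M : Matrix (Fin n) (Fin n) ℝ) :
    NormedSpace.exp M * NormedSpace.exp (-M) = 1 := by
  rw [← Matrix.exp_add_of_commute _ _ (Commute.neg_right (Commute.refl M)), add_neg_cancel,
    NormedSpace.exp_zero]

theorem matLcz_neg (e : Coeffs) (L₁ L₂ : Matrix (Fin n) (Fin n) ℝ) (h : ℝ) :
    matLcz e L₁ L₂ (-h) = matLcz e L₁ L₂ h := by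
  simp only [matLcz, (by decide : Even 2).neg_pow, (by decide : Even 4).neg_pow]

theorem isSymmetricMethod_step (a b : Fin 5 → ℝ) (e : Coeffs)
    (L₁ L₂ : Matrix (Fin n) (Fin n) ℝ) {S : ℝ → Matrix (Fin n) (Fin n) ℝ}
    (hS : IsSymmetricMethod S) : IsSymmetricMethod (step a b e L₁ L₂ S) := by
  intro h
  rw [step_eq_nineProd, step_eq_nineProd]
  refine nineProd_mul_eq_one ?_ ?_ ?_ ?_ (hS h) <;>
    simp only [matLcz_neg, mul_neg, neg_smul, matrix_exp_mul_exp_neg]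

theorem isSymmetricMethod_middleI (a₃ : ℝ) (e : Coeffs) (L₁ L₂ : Matrix (Fin n) (Fin n) ℝ) :
    IsSymmetricMethod (middleI a₃ e L₁ L₂) := by
  intro h
  simp only [middleI, (by decide : Even 4).neg_pow, mul_neg, neg_div, neg_smul]
  generalize (a₃ * h / 2) • L₁ = P
  generalize (2 * e.e52 * h ^ 4 / a₃) • ⁅L₁, commD L₁ L₂⁆ = X
  have h1 := matrix_exp_mul_exp_neg (P - X)
  have h2 := matrix_exp_mul_exp_neg (P + X)
  rw [neg_sub, sub_eq_neg_add X P] at h1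
  rw [neg_add, ← sub_eq_add_neg] at h2
  rw [mul_assoc, ← mul_assoc (NormedSpace.exp (P - X)), h1, one_mul, h2]

theorem isSymmetricMethod_middleII (a₃ : ℝ) (e : Coeffs) (L₁ L₂ : Matrix (Fin n) (Fin n) ℝ) :
    IsSymmetricMethod (middleII a₃ e L₁ L₂) := by
  intro h
  simp only [middleII, (by decide : Even 4).neg_pow, mul_neg, neg_smul]
  generalize (a₃ * h) • L₁ = P
  generalize (e.e52 * h ^ 4 / a₃) • ⁅L₁, commD L₁ L₂⁆ = X
  have h1 := matrix_exp_mul_exp_neg (-X)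
  rw [neg_neg] at h1
  calc _ = NormedSpace.exp X * (NormedSpace.exp P * (NormedSpace.exp (-X) * NormedSpace.exp X) *
        NormedSpace.exp (-P)) * NormedSpace.exp (-X) := by simp only [mul_assoc]
    _ = 1 := by rw [h1, mul_one, matrix_exp_mul_exp_neg, mul_one, matrix_exp_mul_exp_neg]

theorem ring_lie_skew {R : Type*} [Ring R] (x y : R) : ⁅x, y⁆ = -⁅y, x⁆ := by
  simp only [Ring.lie_def, neg_sub]

theorem lie_smul_smul {R : Type*} [Ring R] [Algebra ℝ R] (c d : ℝ) (x y : R) :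
    ⁅c • x, d • y⁆ = (c * d) • ⁅x, y⁆ := by
  simp only [Ring.lie_def, smul_mul_smul_comm, smul_sub, mul_comm d c]

section

open scoped Matrix.Norms.Operator

theorem hasOrder_step {a b : Fin 5 → ℝ} {e : Coeffs} (he : IsClassASolution a b e)
    (L₁ L₂ : Matrix (Fin n) (Fin n) ℝ) {S : ℝ → Matrix (Fin n) (Fin n) ℝ}
    (aS : AnalyticAt ℝ S 0) (cS : Continuous S) (sS : IsSymmetricMethod S)
    (hS : EqO 6 S (fun h => NormedSpace.exp ((a 2 * h) • L₁)
      - h ^ 5 • e.e52 • ⁅L₁, ⁅L₁, commD L₁ L₂⁆⁆)) :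
    HasOrder 6 (step a b e L₁ L₂ S) (L₁ + L₂) := by
  obtain ⟨E, hE, hΦ⟩ := exists_nineProd_eq_exp he L₁ L₂ aS cS sS hS
  refine ⟨E, fun i j => ?_, ?_⟩
  · let ℓ : Matrix (Fin n) (Fin n) ℝ →L[ℝ] ℝ :=
      LinearMap.toContinuousLinearMap (Matrix.entryLinearMap ℝ ℝ i j)
    exact (ℓ.isBigO_comp E (𝓝 0)).trans hE
  · filter_upwards [hΦ] with h hh
    rw [step_eq_nineProd]
    exact hh

theorem hasOrder_methodI {a b : Fin 5 → ℝ} {e : Coeffs} (he : IsClassASolution a b e)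
    (h3 : a 2 ≠ 0) (L₁ L₂ : Matrix (Fin n) (Fin n) ℝ) :
    HasOrder 6 (methodI a b e L₁ L₂) (L₁ + L₂) := by
  refine hasOrder_step he L₁ L₂ ?_ ?_ (isSymmetricMethod_middleI _ e L₁ L₂) ?_
  · unfold middleI
    exact (analyticAt_exp_comp (by fun_prop)).mul (analyticAt_exp_comp (by fun_prop))
  · unfold middleI
    exact (continuous_exp.comp (by fun_prop)).mul (continuous_exp.comp (by fun_prop))
  · have := middleI_eqO ((a 2 / 2) • L₁) ((2 * e.e52 / a 2) • ⁅L₁, commD L₁ L₂⁆)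
    refine (EqO.of_eq fun h => ?_).trans (this.trans (EqO.of_eq fun h => ?_))
    · simp only [middleI, smul_smul]
      -- The scalings `a₃/2` and `2e/a₃` multiply to `e`; the same holds for `a₃` and `e/a₃` in the
      -- second variant. This fixes the coefficient of the commutator correction.
      congr 2 <;> congr 2 <;> ring
    · have e1 : 2 * h * (a 2 / 2) = a 2 * h := by ring
      have e2 : 2 * e.e52 / a 2 * (a 2 / 2) = e.e52 := by field_simp
      rw [smul_smul, e1, lie_smul_smul, e2, ring_lie_skew, smul_neg, smul_neg, sub_eq_add_neg]
      rfl

theorem hasOrder_methodII {a b : Fin 5 → ℝ} {e : Coeffs} (he : IsClassASolution a b e)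
    (h3 : a 2 ≠ 0) (L₁ L₂ : Matrix (Fin n) (Fin n) ℝ) :
    HasOrder 6 (methodII a b e L₁ L₂) (L₁ + L₂) := by
  refine hasOrder_step he L₁ L₂ ?_ ?_ (isSymmetricMethod_middleII _ e L₁ L₂) ?_
  · unfold middleII
    exact ((analyticAt_exp_comp (by fun_prop)).mul (analyticAt_exp_comp (by fun_prop))).mul
      (analyticAt_exp_comp (by fun_prop))
  · unfold middleII
    exact ((continuous_exp.comp (by fun_prop)).mul (continuous_exp.comp (by fun_prop))).mul
      (continuous_exp.comp (by fun_prop))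
  · have := middleII_eqO (a 2 • L₁) ((e.e52 / a 2) • ⁅L₁, commD L₁ L₂⁆)
    refine (EqO.of_eq fun h => ?_).trans (this.trans (EqO.of_eq fun h => ?_))
    · have e1 : e.e52 * h ^ 4 / a 2 = h ^ 4 * (e.e52 / a 2) := by ring
      simp only [middleII, smul_smul, e1, mul_comm (a 2) h]
      rfl
    · rw [smul_smul, mul_comm h, lie_smul_smul, div_mul_cancel₀ _ h3, ring_lie_skew, smul_neg,
        smul_neg, sub_eq_add_neg]
      rfl

end

/-! ### Dissipation -/

/-- Matrices with negative semidefinite symmetric part. -/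
def Dissipative (M : Matrix (Fin n) (Fin n) ℝ) : Prop := ∀ x : Fin n → ℝ, x ⬝ᵥ M *ᵥ x ≤ 0

/-- Matrices that do not increase the Euclidean norm. -/
def Contractive (M : Matrix (Fin n) (Fin n) ℝ) : Prop :=
  ∀ x : Fin n → ℝ, M *ᵥ x ⬝ᵥ M *ᵥ x ≤ x ⬝ᵥ x

theorem Contractive.mul {M N : Matrix (Fin n) (Fin n) ℝ} (hM : Contractive M)
    (hN : Contractive N) : Contractive (M * N) := fun x => by
  rw [← mulVec_mulVec]
  exact (hM _).trans (hN x)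

open scoped Matrix.Norms.Operator in
theorem Dissipative.contractive_exp {M : Matrix (Fin n) (Fin n) ℝ} (hM : Dissipative M) :
    Contractive (NormedSpace.exp M) := by
  intro x
  let ℓ : Matrix (Fin n) (Fin n) ℝ →L[ℝ] (Fin n → ℝ) :=
    LinearMap.toContinuousLinearMap ((Matrix.mulVecBilin ℝ ℝ).flip x)
  have hℓ : ∀ N, ℓ N = N *ᵥ x := fun N => rfl
  have hy : ∀ t : ℝ, HasDerivAt (fun t : ℝ => NormedSpace.exp (t • M) *ᵥ x)
      (M *ᵥ (NormedSpace.exp (t • M) *ᵥ x)) t := by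
    intro t
    have h1 := ℓ.hasFDerivAt.comp_hasDerivAt t (hasDerivAt_exp_smul_const' (𝕂 := ℝ) M t)
    rw [mulVec_mulVec]
    exact h1
  have hg : ∀ t : ℝ, HasDerivAt
      (fun t : ℝ => NormedSpace.exp (t • M) *ᵥ x ⬝ᵥ NormedSpace.exp (t • M) *ᵥ x)
      (2 * (NormedSpace.exp (t • M) *ᵥ x ⬝ᵥ M *ᵥ (NormedSpace.exp (t • M) *ᵥ x))) t := by
    intro t
    have h1 := fun i => (hasDerivAt_pi.1 (hy t)) i
    have h2 := HasDerivAt.fun_sum (u := Finset.univ) fun i _ => (h1 i).mul (h1 i)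
    refine h2.congr_deriv ?_
    simp only [dotProduct, Finset.mul_sum]
    exact Finset.sum_congr rfl fun i _ => by ring
  -- Along the flow `y' = M y` the squared norm has derivative `2 y · M y ≤ 0`; the times `0` and
  -- `1` are compared.
  have ha := antitone_of_deriv_nonpos (fun t => (hg t).differentiableAt) fun t => by
    rw [(hg t).deriv]
    have := hM (NormedSpace.exp (t • M) *ᵥ x)
    linarith
  simpa using ha zero_le_one

theorem dissipative_of_skew {M : Matrix (Fin n) (Fin n) ℝ} (h : Mᵀ = -M) : Dissipative M := by
  intro x
  have h1 : x ⬝ᵥ M *ᵥ x = -(x ⬝ᵥ M *ᵥ x) := by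
    conv_lhs => rw [dotProduct_mulVec, ← mulVec_transpose, h, neg_mulVec, neg_dotProduct,
      dotProduct_comm]
  linarith

theorem Dissipative.add {M N : Matrix (Fin n) (Fin n) ℝ} (hM : Dissipative M)
    (hN : Dissipative N) : Dissipative (M + N) := fun x => by
  rw [add_mulVec, dotProduct_add]
  exact add_nonpos (hM x) (hN x)

theorem Dissipative.smul {M : Matrix (Fin n) (Fin n) ℝ} (hM : Dissipative M) {c : ℝ}
    (hc : 0 ≤ c) : Dissipative (c • M) := fun x => by
  rw [smul_mulVec, dotProduct_smul]
  exact mul_nonpos_of_nonneg_of_nonpos hc (hM x)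

theorem transpose_bracket (M N : Matrix (Fin n) (Fin n) ℝ) : ⁅M, N⁆ᵀ = ⁅Nᵀ, Mᵀ⁆ := by
  simp [Ring.lie_def]

theorem transpose_commC {L₁ L₂ : Matrix (Fin n) (Fin n) ℝ} (h₁ : L₁ᵀ = L₁) (h₂ : L₂ᵀ = -L₂) :
    (commC L₁ L₂)ᵀ = -commC L₁ L₂ := by
  simp only [commC, transpose_sub, transpose_mul, h₁, h₂, Ring.lie_def]
  noncomm_ring

theorem transpose_commD {L₁ L₂ : Matrix (Fin n) (Fin n) ℝ} (h₁ : L₁ᵀ = L₁) (h₂ : L₂ᵀ = -L₂) :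
    (commD L₁ L₂)ᵀ = commD L₁ L₂ := by
  simp only [commD, transpose_sub, transpose_mul, h₁, h₂, Ring.lie_def]
  noncomm_ring

theorem transpose_lie_commD {L₁ L₂ : Matrix (Fin n) (Fin n) ℝ} (h₁ : L₁ᵀ = L₁) (h₂ : L₂ᵀ = -L₂) :
    ⁅L₁, commD L₁ L₂⁆ᵀ = -⁅L₁, commD L₁ L₂⁆ := by
  rw [transpose_bracket, h₁, transpose_commD h₁ h₂, ring_lie_skew]

theorem transpose_matLcz {L₁ L₂ : Matrix (Fin n) (Fin n) ℝ} (h₁ : L₁ᵀ = L₁) (h₂ : L₂ᵀ = -L₂)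
    (e : Coeffs) (h : ℝ) : (matLcz e L₁ L₂ h)ᵀ = -matLcz e L₁ L₂ h := by
  have hC := transpose_commC h₁ h₂
  have hD := transpose_commD h₁ h₂
  have e1 : ⁅L₁, ⁅L₁, commC L₁ L₂⁆⁆ᵀ = -⁅L₁, ⁅L₁, commC L₁ L₂⁆⁆ := by
    simp only [transpose_sub, transpose_mul, h₁, hC, Ring.lie_def]
    noncomm_ring
  have e2 : ⁅L₁, ⁅L₂, commD L₁ L₂⁆⁆ᵀ = -⁅L₁, ⁅L₂, commD L₁ L₂⁆⁆ := by
    simp only [transpose_sub, transpose_mul, h₁, h₂, hD, Ring.lie_def]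
    noncomm_ring
  have e3 : ⁅L₂, ⁅L₂, commC L₁ L₂⁆⁆ᵀ = -⁅L₂, ⁅L₂, commC L₁ L₂⁆⁆ := by
    simp only [transpose_sub, transpose_mul, h₂, hC, Ring.lie_def]
    noncomm_ring
  simp only [matLcz, matZ, transpose_sub, transpose_add, transpose_smul, h₂, hC, e1, e2, e3]
  module

theorem transpose_smul_of_skew {M : Matrix (Fin n) (Fin n) ℝ} (h : Mᵀ = -M) (c : ℝ) :
    (c • M)ᵀ = -(c • M) := by
  rw [transpose_smul, h, smul_neg]

/-- The modified operator is skew, so its exponentials are contractions for either sign of the step.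
Only the flows of `L₁` require non-negative step sizes. -/
theorem dissipationPreserving_step {a b : Fin 5 → ℝ} (e : Coeffs)
    {L₁ L₂ : Matrix (Fin n) (Fin n) ℝ} (h₁ : L₁ᵀ = L₁) (h₂ : L₂ᵀ = -L₂) (hL : Dissipative L₁)
    (ha : ∀ j, 0 ≤ a j) {S : ℝ → Matrix (Fin n) (Fin n) ℝ}
    (hS : ∀ h, 0 ≤ h → Contractive (S h)) : DissipationPreserving (step a b e L₁ L₂ S) := by
  intro h hh x
  have hX : ∀ j, Contractive (NormedSpace.exp ((a j * h) • L₁)) := fun j =>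
    (hL.smul (mul_nonneg (ha j) hh)).contractive_exp
  have hY : ∀ j, Contractive (NormedSpace.exp ((b j * h) • matLcz e L₁ L₂ h)) := fun j =>
    (dissipative_of_skew (transpose_smul_of_skew (transpose_matLcz h₁ h₂ e h) _)).contractive_exp
  have hΦ : Contractive (step a b e L₁ L₂ S h) := by
    unfold step
    exact ((((((((hX 0).mul (hY 0)).mul (hX 1)).mul (hY 1)).mul (hS h hh)).mul (hY 1)).mul
      (hX 1)).mul (hY 0)).mul (hX 0)
  unfold hamiltonian
  have := hΦ x
  linarith

theorem contractive_middleI {a₃ : ℝ} (ha : 0 ≤ a₃) (e : Coeffs)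
    {L₁ L₂ : Matrix (Fin n) (Fin n) ℝ} (h₁ : L₁ᵀ = L₁) (h₂ : L₂ᵀ = -L₂) (hL : Dissipative L₁)
    {h : ℝ} (hh : 0 ≤ h) : Contractive (middleI a₃ e L₁ L₂ h) := by
  have hP : Dissipative ((a₃ * h / 2) • L₁) := hL.smul (by positivity)
  have hX := transpose_smul_of_skew (transpose_lie_commD h₁ h₂) (2 * e.e52 * h ^ 4 / a₃)
  refine (hP.add (dissipative_of_skew hX)).contractive_exp.mul ?_
  rw [sub_eq_add_neg]
  exact (hP.add (dissipative_of_skew (by rw [transpose_neg, hX]))).contractive_exp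

theorem contractive_middleII {a₃ : ℝ} (ha : 0 ≤ a₃) (e : Coeffs)
    {L₁ L₂ : Matrix (Fin n) (Fin n) ℝ} (h₁ : L₁ᵀ = L₁) (h₂ : L₂ᵀ = -L₂) (hL : Dissipative L₁)
    {h : ℝ} (hh : 0 ≤ h) : Contractive (middleII a₃ e L₁ L₂ h) := by
  have hX := transpose_smul_of_skew (transpose_lie_commD h₁ h₂) (e.e52 * h ^ 4 / a₃)
  exact ((dissipative_of_skew hX).contractive_exp.mul
    (hL.smul (by positivity)).contractive_exp).mul
    (dissipative_of_skew (by rw [transpose_neg, hX])).contractive_exp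

end

end PHSplitting

namespace PHSplitting
noncomputable section

/-! ### Expansion coefficients of class-a schemes with five stages -/

/-- The coefficients of `exp (x h L₁)`. -/
def Coeffs.ofGen₁ (x : ℝ) : Coeffs := ⟨x, 0, 0, 0, 0, 0, 0, 0, 0, 0⟩

/-- The coefficients of the class-a scheme with step sizes `a₁, a₂, a₃, b₁, b₂`. -/
def classACoeffs (a₁ a₂ a₃ b₁ b₂ : ℝ) : Coeffs :=
  ((((Coeffs.ofGen₁ a₃).sandwich₂ b₂).sandwich₁ a₂).sandwich₂ b₁).sandwich₁ a₁

theorem series_ofGen₁ (x : ℝ) : (Coeffs.ofGen₁ x).series = hpow 1 (x • gen₁) := by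
  simp [Coeffs.series, Coeffs.ofGen₁, Coeffs.term1, Coeffs.term3, Coeffs.term5, hpow]

/-- The palindrome is built outwards from `exp (a₃ h L₁)`, one pair of equal factors at a time. The
final truncated identity becomes an exact one with the formal logarithm. -/
theorem isExpansion_classACoeffs {a b : Fin 5 → ℝ} (h : ClassA a b) :
    IsExpansion a b (classACoeffs (a 0) (a 1) (a 2) (b 0) (b 1)) := by
  have key : ∀ {F G H K : PowerSeries Free2}, EqTrunc 7 F G → EqTrunc 7 (H * G * H) K →
      EqTrunc 7 (H * F * H) K := fun h h' =>
    (((EqTrunc.refl _).mul h).mul (EqTrunc.refl _)).trans h'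
  have h1 := eqTrunc_sandwich₂ (b 1) (Coeffs.ofGen₁ (a 2))
  have h2 := key h1 (eqTrunc_sandwich₁ (a 1) _)
  have h3 := key h2 (eqTrunc_sandwich₂ (b 0) _)
  have h4 := key h3 (eqTrunc_sandwich₁ (a 0) _)
  rw [series_ofGen₁] at h4
  have h5 : EqTrunc 7 (formalScheme a b)
      (formalExp (classACoeffs (a 0) (a 1) (a 2) (b 0) (b 1)).series) := by
    rw [formalScheme_classA h]
    exact h4
  exact exists_formalExp_eq (by norm_num) (hasCoeffs_hpow _ _ _).h0 h5

/-! ### The one-parameter family solving the linear equations -/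

/-- The second step size as a function of `b₁`. -/
def solA₂ (b : ℝ) : ℝ := 1 / (60 * (b * (1 - b) * (1 - 2 * b) ^ 2))

/-- The central step size as a function of `b₁`. -/
def solA₃ (b : ℝ) : ℝ := 2 / 3 - 2 / (15 * (1 - 2 * b) ^ 2)

/-- The first step size as a function of `b₁`. -/
def solA₁ (b : ℝ) : ℝ := (1 - solA₃ b) / 2 - solA₂ b

/-- The coefficients along the family. -/
def solCoeffs (b : ℝ) : Coeffs :=
  classACoeffs (solA₁ b) (solA₂ b) (solA₃ b) b (1 / 2 - b)

theorem solCoeffs_e11 (b : ℝ) : (solCoeffs b).e11 = 1 := by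
  simp only [solCoeffs, classACoeffs, Coeffs.sandwich₁, Coeffs.sandwich₂, Coeffs.ofGen₁, solA₁]
  ring

theorem solCoeffs_e12 (b : ℝ) : (solCoeffs b).e12 = 1 := by
  simp only [solCoeffs, classACoeffs, Coeffs.sandwich₁, Coeffs.sandwich₂, Coeffs.ofGen₁]
  ring

/-- The brackets of `e₃₂` and `e₅₆` contain `L₁` once, so for fixed `b` these coefficients are
linear in `a`. The family solves them together with `e₁₁ = 1`. -/
theorem solCoeffs_e32 {b : ℝ} (h0 : b ≠ 0) (h1 : 1 - b ≠ 0) (h2 : 1 - 2 * b ≠ 0) :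
    (solCoeffs b).e32 = 0 := by
  simp only [solCoeffs, classACoeffs, Coeffs.sandwich₁, Coeffs.sandwich₂, Coeffs.ofGen₁, solA₁,
    solA₂, solA₃]
  field_simp
  ring

theorem solCoeffs_e56 {b : ℝ} (h0 : b ≠ 0) (h1 : 1 - b ≠ 0) (h2 : 1 - 2 * b ≠ 0) :
    (solCoeffs b).e56 = 0 := by
  simp only [solCoeffs, classACoeffs, Coeffs.sandwich₁, Coeffs.sandwich₂, Coeffs.ofGen₁, solA₁,
    solA₂, solA₃]
  field_simp
  ring

theorem exists_solCoeffs_e54_eq_zero :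
    ∃ b ∈ Set.Icc (0.235760333252795278060069350297 : ℝ) 0.235760333252795278060069350298,
      (solCoeffs b).e54 = 0 := by
  have hc : ContinuousOn (fun b => (solCoeffs b).e54)
      (Set.Icc (0.235760333252795278060069350297 : ℝ) 0.235760333252795278060069350298) := by
    have c2 : ContinuousOn solA₂ (Set.Icc (0.235760333252795278060069350297 : ℝ)
        0.235760333252795278060069350298) := by
      unfold solA₂
      refine ContinuousOn.div (by fun_prop) (by fun_prop) fun b hb => ?_
      have h1 : 0 < b := by linarith [hb.1]
      have h2 : 0 < 1 - b := by linarith [hb.2]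
      have h3 : 0 < 1 - 2 * b := by linarith [hb.2]
      positivity
    have c3 : ContinuousOn solA₃ (Set.Icc (0.235760333252795278060069350297 : ℝ)
        0.235760333252795278060069350298) := by
      unfold solA₃
      refine ContinuousOn.sub (by fun_prop) (ContinuousOn.div (by fun_prop) (by fun_prop) ?_)
      intro b hb
      have h3 : 0 < 1 - 2 * b := by linarith [hb.2]
      positivity
    have c1 : ContinuousOn solA₁ (Set.Icc (0.235760333252795278060069350297 : ℝ)
        0.235760333252795278060069350298) := by
      unfold solA₁
      fun_prop
    simp only [solCoeffs, classACoeffs, Coeffs.sandwich₁, Coeffs.sandwich₂, Coeffs.ofGen₁]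
    fun_prop
  -- The endpoints enclose a numerical root to thirty digits. Such precision leaves room for the
  -- generous error amplification of the later estimates.
  have hl : (solCoeffs 0.235760333252795278060069350297).e54 ≤ 0 := by
    simp only [solCoeffs, classACoeffs, Coeffs.sandwich₁, Coeffs.sandwich₂, Coeffs.ofGen₁, solA₁,
      solA₂, solA₃]
    norm_num
  have hu : 0 ≤ (solCoeffs 0.235760333252795278060069350298).e54 := by
    simp only [solCoeffs, classACoeffs, Coeffs.sandwich₁, Coeffs.sandwich₂, Coeffs.ofGen₁, solA₁,
      solA₂, solA₃]
    norm_num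
  exact intermediate_value_Icc (by norm_num) hc ⟨hl, hu⟩

end

end PHSplitting

namespace PHSplitting
noncomputable section

/-! ### Error propagation -/

/-- `x` and `X` differ by at most `k ε`. -/
def Dist (ε k x X : ℝ) : Prop := |x - X| ≤ k * ε

/-- `x` and `X` are at most one in absolute value and differ by at most `k ε`. -/
structure UnitDist (ε k x X : ℝ) : Prop where
  left : |x| ≤ 1
  right : |X| ≤ 1
  dist : Dist ε k x X

variable {ε k l x y X Y : ℝ}

theorem Dist.add (h : Dist ε k x X) (h' : Dist ε l y Y) : Dist ε (k + l) (x + y) (X + Y) := by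
  unfold Dist at *
  rw [add_sub_add_comm, add_mul]
  exact (abs_add_le _ _).trans (add_le_add h h')

theorem Dist.sub (h : Dist ε k x X) (h' : Dist ε l y Y) : Dist ε (k + l) (x - y) (X - Y) := by
  unfold Dist at *
  rw [sub_sub_sub_comm, add_mul]
  exact (abs_sub _ _).trans (add_le_add h h')

theorem Dist.mono (hε : 0 ≤ ε) (h : Dist ε k x X) (hkl : k ≤ l) : Dist ε l x X :=
  le_trans h (mul_le_mul_of_nonneg_right hkl hε)

/-- The factor `2` in the linear coefficients is the only constant above one in the recursion, so it
falls outside `UnitDist.mul`. -/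
theorem Dist.two_mul (h : Dist ε k x X) : Dist ε (2 * k) (2 * x) (2 * X) := by
  unfold Dist at *
  rw [← mul_sub, abs_mul, mul_assoc, abs_two]
  linarith

theorem UnitDist.const (h : |x| ≤ 1) : UnitDist ε 0 x x := ⟨h, h, by simp [Dist]⟩

/-- For quantities bounded by one, the error multiples simply add. A monomial thus has an error of
at most its degree times `ε`. -/
theorem UnitDist.mul (h : UnitDist ε k x X) (h' : UnitDist ε l y Y) :
    UnitDist ε (k + l) (x * y) (X * Y) := by
  refine ⟨?_, ?_, ?_⟩
  · rw [abs_mul]; exact mul_le_one₀ h.left (abs_nonneg _) h'.left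
  · rw [abs_mul]; exact mul_le_one₀ h.right (abs_nonneg _) h'.right
  · have e1 : x * y - X * Y = (x - X) * y + X * (y - Y) := by ring
    have h1 := h.dist
    have h2 := h'.dist
    unfold Dist at *
    rw [e1]
    refine (abs_add_le _ _).trans ?_
    rw [abs_mul, abs_mul, add_mul]
    exact add_le_add ((mul_le_of_le_one_right (abs_nonneg _) h'.left).trans h1)
      ((mul_le_of_le_one_left (abs_nonneg _) h.right).trans h2)

theorem UnitDist.pow (h : UnitDist ε k x X) (n : ℕ) : UnitDist ε (n * k) (x ^ n) (X ^ n) := by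
  induction n with
  | zero => simpa using UnitDist.const (by simp)
  | succ n ih =>
    rw [pow_succ, pow_succ, Nat.cast_succ, add_mul, one_mul]
    exact ih.mul h

theorem UnitDist.div (h : UnitDist ε k x X) {c : ℝ} (hc : 1 ≤ c) :
    UnitDist ε k (x / c) (X / c) := by
  have h0 : 0 < c := by linarith
  refine ⟨?_, ?_, ?_⟩
  · rw [abs_div, abs_of_pos h0]; exact (div_le_self (abs_nonneg _) hc).trans h.left
  · rw [abs_div, abs_of_pos h0]; exact (div_le_self (abs_nonneg _) hc).trans h.right
  · have h1 := h.dist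
    unfold Dist at *
    rw [← sub_div, abs_div, abs_of_pos h0]
    exact (div_le_self (abs_nonneg _) hc).trans h1

/-- Componentwise `UnitDist` of two coefficient tuples. -/
structure Coeffs.UnitNear (ε : ℝ) (e E : Coeffs) : Prop where
  e11 : UnitDist ε 1 e.e11 E.e11
  e12 : UnitDist ε 1 e.e12 E.e12
  e31 : UnitDist ε 1 e.e31 E.e31
  e32 : UnitDist ε 1 e.e32 E.e32
  e51 : UnitDist ε 1 e.e51 E.e51
  e52 : UnitDist ε 1 e.e52 E.e52
  e53 : UnitDist ε 1 e.e53 E.e53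
  e54 : UnitDist ε 1 e.e54 E.e54
  e55 : UnitDist ε 1 e.e55 E.e55
  e56 : UnitDist ε 1 e.e56 E.e56

/-- Componentwise `Dist` of two coefficient tuples. -/
structure Coeffs.Near (ε k : ℝ) (e E : Coeffs) : Prop where
  e11 : Dist ε k e.e11 E.e11
  e12 : Dist ε k e.e12 E.e12
  e31 : Dist ε k e.e31 E.e31
  e32 : Dist ε k e.e32 E.e32
  e51 : Dist ε k e.e51 E.e51
  e52 : Dist ε k e.e52 E.e52
  e53 : Dist ε k e.e53 E.e53
  e54 : Dist ε k e.e54 E.e54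
  e55 : Dist ε k e.e55 E.e55
  e56 : Dist ε k e.e56 E.e56

/-- The error multiples are summed over the monomials of each polynomial; `50` is a uniform bound
for these sums. -/
theorem Coeffs.UnitNear.sandwich₁ (hε : 0 ≤ ε) {e E : Coeffs} (h : e.UnitNear ε E)
    (hx : UnitDist ε 1 x X) : (e.sandwich₁ x).Near ε 50 (E.sandwich₁ X) := by
  constructor <;> dsimp only [Coeffs.sandwich₁] <;> apply Dist.mono hε
  all_goals
    repeat' first
      | exact h.e11 | exact h.e12 | exact h.e31 | exact h.e32 | exact h.e51 | exact h.e52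
      | exact h.e53 | exact h.e54 | exact h.e55 | exact h.e56 | exact hx
      | with_reducible apply Dist.sub | with_reducible apply Dist.add | with_reducible apply Dist.two_mul | with_reducible apply UnitDist.dist
      | with_reducible apply UnitDist.pow | with_reducible apply UnitDist.const | with_reducible apply UnitDist.mul | with_reducible apply UnitDist.div
  all_goals norm_num [abs_le]

theorem Coeffs.UnitNear.sandwich₂ (hε : 0 ≤ ε) {e E : Coeffs} (h : e.UnitNear ε E)
    (hx : UnitDist ε 1 x X) : (e.sandwich₂ x).Near ε 50 (E.sandwich₂ X) := by
  constructor <;> dsimp only [Coeffs.sandwich₂] <;> apply Dist.mono hε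
  all_goals
    repeat' first
      | exact h.e11 | exact h.e12 | exact h.e31 | exact h.e32 | exact h.e51 | exact h.e52
      | exact h.e53 | exact h.e54 | exact h.e55 | exact h.e56 | exact hx
      | with_reducible apply Dist.sub | with_reducible apply Dist.add | with_reducible apply Dist.two_mul | with_reducible apply UnitDist.dist
      | with_reducible apply UnitDist.pow | with_reducible apply UnitDist.const | with_reducible apply UnitDist.mul | with_reducible apply UnitDist.div
  all_goals norm_num [abs_le]

/-- All coefficients but `e₁₂` are at most `9/10` in absolute value, and `|e₁₂| ≤ 1`. -/
structure Coeffs.Small (E : Coeffs) : Prop where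
  e11 : |E.e11| ≤ 9 / 10
  e12 : |E.e12| ≤ 1
  e31 : |E.e31| ≤ 9 / 10
  e32 : |E.e32| ≤ 9 / 10
  e51 : |E.e51| ≤ 9 / 10
  e52 : |E.e52| ≤ 9 / 10
  e53 : |E.e53| ≤ 9 / 10
  e54 : |E.e54| ≤ 9 / 10
  e55 : |E.e55| ≤ 9 / 10
  e56 : |E.e56| ≤ 9 / 10

theorem UnitDist.of_dist {F : ℝ} (h : Dist ε 50 x F) (hF : Dist ε 1 F X) (hx : |x| ≤ 1)
    (hX : |X| ≤ 1) : UnitDist (51 * ε) 1 x X := by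
  refine ⟨hx, hX, ?_⟩
  unfold Dist at *
  rw [abs_le] at *
  constructor <;> linarith [h.1, h.2, hF.1, hF.2]

theorem UnitDist.of_dist_of_small {F : ℝ} (h : Dist ε 50 x F) (hF : Dist ε 1 F X)
    (hε : ε ≤ 1 / 1000) (hX : |X| ≤ 9 / 10) : UnitDist (51 * ε) 1 x X := by
  refine UnitDist.of_dist h hF ?_ (by linarith)
  unfold Dist at *
  rw [abs_le] at *
  constructor <;> linarith [h.1, h.2, hF.1, hF.2]

/-- One stage multiplies the error by `50` and rounding adds `1`, whence `51`. The margin below one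
restores the unit bounds. It is missing for `e₁₂`, which reaches `1` at the third stage, so that
bound is supplied from the exact value. -/
theorem Coeffs.Near.unitNear {e F E : Coeffs} (h : e.Near ε 50 F) (hF : F.Near ε 1 E)
    (hE : E.Small) (hε : ε ≤ 1 / 1000) (h12 : |e.e12| ≤ 1) : e.UnitNear (51 * ε) E where
  e11 := UnitDist.of_dist_of_small h.e11 hF.e11 hε hE.e11
  e12 := UnitDist.of_dist h.e12 hF.e12 h12 hE.e12
  e31 := UnitDist.of_dist_of_small h.e31 hF.e31 hε hE.e31
  e32 := UnitDist.of_dist_of_small h.e32 hF.e32 hε hE.e32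
  e51 := UnitDist.of_dist_of_small h.e51 hF.e51 hε hE.e51
  e52 := UnitDist.of_dist_of_small h.e52 hF.e52 hε hE.e52
  e53 := UnitDist.of_dist_of_small h.e53 hF.e53 hε hE.e53
  e54 := UnitDist.of_dist_of_small h.e54 hF.e54 hε hE.e54
  e55 := UnitDist.of_dist_of_small h.e55 hF.e55 hε hE.e55
  e56 := UnitDist.of_dist_of_small h.e56 hF.e56 hε hE.e56

/-! ### Numerical values -/

/-- Rounded coefficients after one multiplication. -/
def approx₁ : Coeffs where
  e11 := 0.189266331739231131644835976559755524
  e12 := 0.528479333494409443879861299405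
  e31 := 0.001577587630678215712346371896650921
  e32 := 0.002202511275852645430708354485603586
  e51 := -0.000000941865679406074297015168647585
  e52 := -0.000015779559161517989317247601172235
  e53 := -0.000014686836325445419414773621256372
  e54 := 0.000005259853053839329772415867057412
  e55 := -0.000011015127244084064561080215942279
  e56 := -0.000017941591158744715386374757789655

/-- Rounded coefficients after two multiplications. -/
def approx₂ : Coeffs where
  e11 := 0.851669522783095378949598359445633086
  e12 := 0.528479333494409443879861299405
  e31 := -0.01360560670283799116563429015773709
  e32 := -0.013214393400516413926202619912643616
  e51 := 0.000268147781626994079590212855943369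
  e52 := 0.000218915268977550874427676212636568
  e53 := -0.000104631906952838998702116618593951
  e54 := 0.00034119009699926768873068492731419
  e55 := 0.00045157638125952796861178281348398
  e56 := 0.000053821634928887755376956296995947

/-- Rounded coefficients after three multiplications. -/
def approx₃ : Coeffs where
  e11 := 0.851669522783095378949598359445633086
  e12 := 1
  e31 := 0.014895498335916830928896761028028308
  e32 := 0.012360873101408718420866803379530575
  e51 := -0.000076402540822342027919598942852078
  e52 := -0.000442610556549875129101406766331924
  e53 := -0.000274300446921813987016518749268142
  e54 := 0.000053593384198722741269420663224609
  e55 := -0.000242564921876227931623774784162411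
  e56 := -0.000206014551690145307014446722992175

/-- Rounded coefficients after four multiplications. -/
def approx₄ : Coeffs where
  e11 := 1
  e12 := 1
  e31 := 0.003451372337482890043649467956957812
  e32 := -0.000000000000000000000000000000000001
  e51 := -0.000016842661320395494264260600917559
  e52 := -0.000042236874448324784050737669778638
  e53 := -0.000007169421700016844294104672378627
  e54 := -0.000000000000000000000000000000000015
  e55 := -0.000013885239090892824718783399870074
  e56 := 0.000000000000000000000000000000000001

/-- Monotonicity in `(1 - 2b)²` reduces the claim to the endpoints; `0.528…404` and `0.528…406` are
the extreme values of `1 - 2b`. -/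
theorem solA₃_dist {b : ℝ}
    (hb : b ∈ Set.Icc (0.235760333252795278060069350297 : ℝ) 0.235760333252795278060069350298) :
    UnitDist 1e-28 1 (solA₃ b) 0.189266331739231131644835976559755524 := by
  obtain ⟨hl, hu⟩ := hb
  have h1 : (0.528479333494409443879861299404 : ℝ) ^ 2 ≤ (1 - 2 * b) ^ 2 := by
    gcongr
    linarith
  have h2 : (1 - 2 * b) ^ 2 ≤ (0.528479333494409443879861299406 : ℝ) ^ 2 := by
    gcongr <;> linarith
  have h3 : 2 / (15 * (1 - 2 * b) ^ 2) ≤ 2 / (15 * (0.528479333494409443879861299404 : ℝ) ^ 2) := by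
    gcongr
  have h4 : 2 / (15 * (0.528479333494409443879861299406 : ℝ) ^ 2) ≤ 2 / (15 * (1 - 2 * b) ^ 2) := by
    have : 0 < (1 - 2 * b) ^ 2 := lt_of_lt_of_le (by norm_num) h1
    gcongr
  norm_num at h3 h4
  refine ⟨?_, by norm_num [abs_le], ?_⟩
  · unfold solA₃
    rw [abs_le]
    constructor <;> linarith
  · unfold solA₃ Dist
    rw [abs_le]
    constructor <;> linarith

theorem solA₂_dist {b : ℝ}
    (hb : b ∈ Set.Icc (0.235760333252795278060069350297 : ℝ) 0.235760333252795278060069350298) :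
    UnitDist 1e-28 1 (solA₂ b) 0.331201595521932123652381191442938781 := by
  obtain ⟨hl, hu⟩ := hb
  have h1 : (0.528479333494409443879861299404 : ℝ) ^ 2 ≤ (1 - 2 * b) ^ 2 := by
    gcongr
    linarith
  have h2 : (1 - 2 * b) ^ 2 ≤ (0.528479333494409443879861299406 : ℝ) ^ 2 := by
    gcongr <;> linarith
  have h0 : 0 ≤ 1 - b := by linarith
  have h3 : (0.235760333252795278060069350297 * 0.764239666747204721939930649702 *
      0.528479333494409443879861299404 ^ 2 : ℝ) ≤ b * (1 - b) * (1 - 2 * b) ^ 2 := by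
    gcongr <;> linarith
  have h4 : b * (1 - b) * (1 - 2 * b) ^ 2 ≤ (0.235760333252795278060069350298 *
      0.764239666747204721939930649703 * 0.528479333494409443879861299406 ^ 2 : ℝ) := by
    gcongr <;> linarith
  have h5 : 1 / (60 * (b * (1 - b) * (1 - 2 * b) ^ 2)) ≤ 1 / (60 *
      (0.235760333252795278060069350297 * 0.764239666747204721939930649702 *
      0.528479333494409443879861299404 ^ 2 : ℝ)) := by
    gcongr
  have h6 : 1 / (60 * (0.235760333252795278060069350298 * 0.764239666747204721939930649703 *
      0.528479333494409443879861299406 ^ 2 : ℝ)) ≤ 1 / (60 * (b * (1 - b) * (1 - 2 * b) ^ 2)) := by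
    have : 0 < b * (1 - b) * (1 - 2 * b) ^ 2 := lt_of_lt_of_le (by norm_num) h3
    gcongr
  norm_num at h5 h6
  refine ⟨?_, by norm_num [abs_le], ?_⟩
  · unfold solA₂
    rw [abs_le]
    norm_num
    constructor <;> linarith
  · unfold solA₂ Dist
    rw [abs_le]
    norm_num
    constructor <;> linarith

theorem solA₁_dist {b : ℝ}
    (hb : b ∈ Set.Icc (0.235760333252795278060069350297 : ℝ) 0.235760333252795278060069350298) :
    UnitDist 1e-28 2 (solA₁ b) 0.074165238608452310525200820277183457 := by
  have h2 := abs_le.1 (solA₂_dist hb).dist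
  have h3 := abs_le.1 (solA₃_dist hb).dist
  norm_num at h2 h3
  refine ⟨?_, by norm_num [abs_le], ?_⟩
  · unfold solA₁
    rw [abs_le]
    constructor <;> linarith
  · unfold solA₁ Dist
    rw [abs_le]
    constructor <;> linarith

theorem UnitDist.mono {δ : ℝ} (h : UnitDist ε k x X) (hkl : k * ε ≤ l * δ) : UnitDist δ l x X :=
  ⟨h.left, h.right, le_trans h.dist hkl⟩

theorem near_approx₁ : ((Coeffs.ofGen₁ 0.189266331739231131644835976559755524).sandwich₂ 0.2642396667472047219399306497025).Near 1e-28 1 approx₁ := by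
  constructor <;> norm_num [Dist, Coeffs.sandwich₂, Coeffs.ofGen₁, approx₁, abs_le]

theorem near_approx₂ : (approx₁.sandwich₁ 0.331201595521932123652381191442938781).Near 1e-28 1 approx₂ := by
  constructor <;> norm_num [Dist, Coeffs.sandwich₁, approx₁, approx₂, abs_le]

theorem near_approx₃ : (approx₂.sandwich₂ 0.2357603332527952780600693502975).Near 1e-28 1 approx₃ := by
  constructor <;> norm_num [Dist, Coeffs.sandwich₂, approx₂, approx₃, abs_le]

theorem near_approx₄ : (approx₃.sandwich₁ 0.074165238608452310525200820277183457).Near 1e-28 1 approx₄ := by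
  constructor <;> norm_num [Dist, Coeffs.sandwich₁, approx₃, approx₄, abs_le]

theorem small_approx₁ : approx₁.Small := by
  constructor <;> norm_num [approx₁, abs_le]

theorem small_approx₂ : approx₂.Small := by
  constructor <;> norm_num [approx₂, abs_le]

theorem small_approx₃ : approx₃.Small := by
  constructor <;> norm_num [approx₃, abs_le]

theorem Coeffs.Near.mono {δ : ℝ} {e E : Coeffs} (h : e.Near ε 1 E) (hd : ε ≤ δ) :
    e.Near δ 1 E := by
  have key : ∀ {x X : ℝ}, Dist ε 1 x X → Dist δ 1 x X := fun h => le_trans h (by linarith)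
  exact ⟨key h.e11, key h.e12, key h.e31, key h.e32, key h.e51, key h.e52, key h.e53, key h.e54,
    key h.e55, key h.e56⟩

theorem Coeffs.Near.trans {e F E : Coeffs} (h : e.Near ε k F) (h' : F.Near ε l E) :
    e.Near ε (k + l) E := by
  have key : ∀ {x y X : ℝ}, Dist ε k x y → Dist ε l y X → Dist ε (k + l) x X := fun h h' => by
    unfold Dist at *
    rw [add_mul]
    exact (abs_sub_le _ _ _).trans (add_le_add h h')
  exact ⟨key h.e11 h'.e11, key h.e12 h'.e12, key h.e31 h'.e31, key h.e32 h'.e32,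
    key h.e51 h'.e51, key h.e52 h'.e52, key h.e53 h'.e53, key h.e54 h'.e54, key h.e55 h'.e55,
    key h.e56 h'.e56⟩

theorem solCoeffs_near {b : ℝ}
    (hb : b ∈ Set.Icc (0.235760333252795278060069350297 : ℝ) 0.235760333252795278060069350298) :
    (solCoeffs b).Near 1e-21 1 approx₄ := by
  have h1 := solA₁_dist hb
  have h2 := solA₂_dist hb
  have h3 := solA₃_dist hb
  obtain ⟨hl, hu⟩ := hb
  have h4 : UnitDist 1e-28 1 b 0.2357603332527952780600693502975 := by
    refine ⟨abs_le.2 ⟨?_, ?_⟩, by norm_num [abs_le], abs_le.2 ⟨?_, ?_⟩⟩ <;> linarith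
  have h5 : UnitDist 1e-28 1 (1 / 2 - b) 0.2642396667472047219399306497025 := by
    refine ⟨abs_le.2 ⟨?_, ?_⟩, by norm_num [abs_le], abs_le.2 ⟨?_, ?_⟩⟩ <;> linarith
  have hz : UnitDist 1e-28 1 0 0 := (UnitDist.const (ε := 1) (by simp)).mono (by norm_num)
  have u0 : (Coeffs.ofGen₁ (solA₃ b)).UnitNear 1e-28
      (Coeffs.ofGen₁ 0.189266331739231131644835976559755524) :=
    ⟨h3, hz, hz, hz, hz, hz, hz, hz, hz, hz⟩
  have u1 := (u0.sandwich₂ (by norm_num) h5).unitNear near_approx₁ small_approx₁ (by norm_num) (by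
    simp only [Coeffs.sandwich₂, Coeffs.ofGen₁]
    rw [abs_le]
    constructor <;> linarith)
  have u2 := (u1.sandwich₁ (by norm_num) (h2.mono (by norm_num))).unitNear
    (near_approx₂.mono (by norm_num)) small_approx₂ (by norm_num) (by
    simp only [Coeffs.sandwich₂, Coeffs.sandwich₁, Coeffs.ofGen₁]
    rw [abs_le]
    constructor <;> linarith)
  have u3 := (u2.sandwich₂ (by norm_num) (h4.mono (by norm_num))).unitNear
    (near_approx₃.mono (by norm_num)) small_approx₃ (by norm_num) (by
    simp only [Coeffs.sandwich₂, Coeffs.sandwich₁, Coeffs.ofGen₁]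
    rw [abs_le]
    constructor <;> linarith)
  have n4 := (u3.sandwich₁ (by norm_num) (h1.mono (by norm_num))).trans
    (near_approx₄.mono (by norm_num))
  -- Four stages amplify `10⁻²⁸` by `51⁴ < 10⁷`.
  have key : ∀ {x X : ℝ}, Dist (51 * (51 * (51 * 1e-28))) (50 + 1) x X → Dist 1e-21 1 x X :=
    fun h => le_trans h (by norm_num)
  exact ⟨key n4.e11, key n4.e12, key n4.e31, key n4.e32, key n4.e51, key n4.e52, key n4.e53,
    key n4.e54, key n4.e55, key n4.e56⟩

theorem exists_tabulated_solution :
    ∃ (a b : Fin 5 → ℝ) (e : Coeffs), IsClassASolution a b e ∧ IsTabulated a b e := by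
  obtain ⟨b, hb, h54⟩ := exists_solCoeffs_e54_eq_zero
  have h1 := abs_le.1 (solA₁_dist hb).dist
  have h2 := abs_le.1 (solA₂_dist hb).dist
  have h3 := abs_le.1 (solA₃_dist hb).dist
  have hn := solCoeffs_near hb
  obtain ⟨hl, hu⟩ := hb
  have hb0 : b ≠ 0 := by linarith
  have hb1 : 1 - b ≠ 0 := by linarith
  have hb2 : 1 - 2 * b ≠ 0 := by linarith
  have hA : ClassA ![solA₁ b, solA₂ b, solA₃ b, solA₂ b, solA₁ b]
      ![b, 1 / 2 - b, 1 / 2 - b, b, 0] := by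
    refine ⟨fun i => ?_, fun i hi => ?_, fun i j hij => ?_⟩
    · fin_cases i <;> rfl
    · obtain rfl : i = 4 := Fin.ext (by simpa using hi)
      rfl
    · fin_cases i <;> fin_cases j <;> first | rfl | simp at hij
  refine ⟨_, _, solCoeffs b, ⟨hA, fun j => ?_, fun j => ?_, isExpansion_classACoeffs hA,
    solCoeffs_e11 b, solCoeffs_e12 b, solCoeffs_e32 hb0 hb1 hb2, h54,
    solCoeffs_e56 hb0 hb1 hb2⟩, ?_⟩
  · have p1 : 0 ≤ solA₁ b := by linarith
    have p2 : 0 ≤ solA₂ b := by linarith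
    have p3 : 0 ≤ solA₃ b := by linarith
    fin_cases j <;> assumption
  · have p1 : 0 ≤ b := by linarith
    have p2 : 0 ≤ 1 / 2 - b := by linarith
    fin_cases j <;> first | assumption | exact le_refl (0 : ℝ)
  · have n31 := hn.e31
    have n51 := abs_le.1 hn.e51
    have n52 := abs_le.1 hn.e52
    have n53 := abs_le.1 hn.e53
    have n55 := abs_le.1 hn.e55
    have u31 : UnitDist 1e-21 1 (solCoeffs b).e31 approx₄.e31 := by
      refine ⟨?_, ?_, n31⟩
      · have := abs_le.1 n31
        rw [abs_le]
        simp only [approx₄] at this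
        constructor <;> linarith
      · norm_num [approx₄, abs_le]
    -- The modified coefficient `ẽ₅₁` contains `e₃₁²`, whose error must be bounded separately.
    have sq := abs_le.1 (u31.pow 2).dist
    have n31 := abs_le.1 n31
    simp only [approx₄] at n31 n51 n52 n53 n55 sq
    norm_num at sq
    constructor <;> refine abs_le.2 ⟨?_, ?_⟩ <;>
      first | linarith | (simp only [Coeffs.e51t]; linarith) | (simp only [Matrix.cons_val]; linarith)

end

end PHSplitting

theorem mainTheorem3 :
    (∃ (a b : Fin 5 → ℝ) (e : PHSplitting.Coeffs),
      PHSplitting.IsClassASolution a b e ∧ PHSplitting.IsTabulated a b e) ∧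
    ∀ (a b : Fin 5 → ℝ) (e : PHSplitting.Coeffs),
      PHSplitting.IsClassASolution a b e → 0 < a 2 →
      ∀ (n : ℕ) (J R : Matrix (Fin n) (Fin n) ℝ), J.transpose = -J → R.PosSemidef →
        (PHSplitting.HasOrder 6 (PHSplitting.methodI a b e (-R) J) (J - R) ∧
          PHSplitting.DissipationPreserving (PHSplitting.methodI a b e (-R) J) ∧
          PHSplitting.IsSymmetricMethod (PHSplitting.methodI a b e (-R) J)) ∧
        (PHSplitting.HasOrder 6 (PHSplitting.methodII a b e (-R) J) (J - R) ∧
          PHSplitting.DissipationPreserving (PHSplitting.methodII a b e (-R) J) ∧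
          PHSplitting.IsSymmetricMethod (PHSplitting.methodII a b e (-R) J)) := by
  open PHSplitting in
  refine ⟨exists_tabulated_solution, fun a b e he ha n J R hJ hR => ?_⟩
  have hRt : (-R).transpose = -R := by
    rw [Matrix.transpose_neg, ← Matrix.conjTranspose_eq_transpose_of_trivial, hR.isHermitian.eq]
  have hL : Dissipative (-R) := fun x => by
    have := hR.dotProduct_mulVec_nonneg x
    rw [star_trivial] at this
    rw [Matrix.neg_mulVec, dotProduct_neg]
    linarith
  have hsum : J - R = -R + J := by abel
  rw [hsum]
  exact ⟨⟨hasOrder_methodI he ha.ne' _ _,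
      dissipationPreserving_step e hRt hJ hL he.a_nonneg fun h hh =>
        contractive_middleI ha.le e hRt hJ hL hh,
      isSymmetricMethod_step a b e _ _ (isSymmetricMethod_middleI _ e _ _)⟩,
    ⟨hasOrder_methodII he ha.ne' _ _,
      dissipationPreserving_step e hRt hJ hL he.a_nonneg fun h hh =>
        contractive_middleII ha.le e hRt hJ hL hh,
      isSymmetricMethod_step a b e _ _ (isSymmetricMethod_middleII _ e _ _)⟩⟩
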